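/- **Theorem.** Write $\mathcal V_g f(x,\xi)=\int_{\mathbb R} f(t)\overline{g(t-x)}e^{-2\pi i\xi t}\,dt$ for $f,g\in L^2(\mathbb R)$. A continuous function $\gamma:\mathbb R^d\to[0,\infty)$ is a *translation stable weight* (TSW) with controlling function $\mu$ if $\mu:\mathbb R^d\to[0,\infty)$ is locally bounded and $\gamma(z+\tau)\le\mu(\tau)\gamma(z)$ for all $z,\tau\in\mathbb R^d$. A pair $(g,\gamma)$ of a window $g\in L^2(\mathbb R)$ and a TSW $\gamma$ on $\mathbb R^2$ is *admissible* if $|\mathcal V_g g|$ is a TSW with a controlling function $\mu$ such that $\mu\in L^2(\gamma*\mathcal R\gamma)$, that is, $\mu$ is measurable and $\int_{\mathbb R^2}\mu^2\,(\gamma*\mathcal R\gamma)<\infty$, where $\mathcal R\gamma(z)=\gamma(-z)$ and $(\gamma*\mathcal R\gamma)(z)=\int_{\mathbb R^2}\gamma(y)\gamma(y-z)\,dy\in[0,\infty]$. For weights $v,w\ge 0$ on $\mathbb R^d$, the Poincaré constant $C_P(v,w)\in[0,\infty]$ is the infimum of all finite $K$ such that $\inf_{c\in\mathbb C}\int|u-c|^2v\le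 K\int|\nabla u|^2w$ for all $u\in C_b^\infty(\mathbb R^d)$ (complex-valued smooth functions that are bounded together with all their derivatives), with $\inf\emptyset=\infty$. For measurable $\chi:\mathbb R^d\to[0,\infty)$ put $$\|F\|_{\mathcal L(\chi)}=\Big(\int_{\mathbb R^d}\|F\|_{L^2(B_1(\tau))}^4\,\chi(\tau)\,d\tau\Big)^{1/4},\qquad \mathfrak d(\phi,\psi)=\|\phi^2-\psi^2\|_{L^2(\mathbb R^d)}^{1/2}.$$ Let $(g,\gamma)$ be an admissible pair with $\gamma\not\equiv0$. There is a finite constant $C>0$, depending on $g$ and $\gamma$ only, such that for every measurable $\chi:\mathbb R^2\to[0,1]$ and all $F,H\in\mathcal V_g(L^2(\mathbb R))$, $$\inf_{|\lambda|=1}\|H-\lambda F\|_{\mathcal L(\chi)}\le C\,\big(1+C_P(w\chi,w)\big)^{1/4}\cdot\mathfrak d(|F|,|H|),\qquad w=(|F|^2*\gamma)^2,$$ where $\infty\cdot0=0$ on the right-hand side. -/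

import Mathlib

open MeasureTheory
open scoped NNReal ENNReal Topology ContDiff ComplexConjugate

/-- The short-time Fourier transform of `f` with respect to the window `g`, at the point
`z = (x, ξ)` of the time-frequency plane:
`∫ f(t) * conj (g(t - x)) * exp(-2πi ξ t) dt`. -/
noncomputable def stft (g f : ℝ → ℂ) (z : EuclideanSpace ℝ (Fin 2)) : ℂ :=
  ∫ t : ℝ, f t * conj (g (t - z 0)) * Complex.exp (-(2 * Real.pi * Complex.I * (z 1) * t))

/-- The function class `V_g(L²(ℝ))`, the image of `L²(ℝ)` under the STFT with window `g`. -/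
def stftRange (g : ℝ → ℂ) : Set (EuclideanSpace ℝ (Fin 2) → ℂ) :=
  {F | ∃ f : ℝ → ℂ, MemLp f 2 volume ∧ F = stft g f}

/-- `μ` is locally bounded: every point has a neighbourhood on which `μ` is bounded. -/
def IsLocallyBdd {d : ℕ} (μ : EuclideanSpace ℝ (Fin d) → ℝ≥0) : Prop :=
  ∀ z, ∃ U ∈ 𝓝 z, ∃ B : ℝ≥0, ∀ y ∈ U, μ y ≤ B

/-- `γ` is a translation stable weight with controlling function `μ`. -/
structure IsTSWWith {d : ℕ} (γ μ : EuclideanSpace ℝ (Fin d) → ℝ≥0) : Prop where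
  continuous : Continuous γ
  locallyBdd : IsLocallyBdd μ
  le_mul : ∀ z τ, γ (z + τ) ≤ μ τ * γ z

/-- `γ` is a translation stable weight (TSW). -/
def IsTSW {d : ℕ} (γ : EuclideanSpace ℝ (Fin d) → ℝ≥0) : Prop :=
  ∃ μ, IsTSWWith γ μ

/-- The weight `γ ∗ Rγ`, where `Rγ(z) = γ(-z)`. It takes values in `[0, ∞]`, so that no
integrability of `γ` is presupposed. -/
noncomputable def selfCorrelation {d : ℕ} (γ : EuclideanSpace ℝ (Fin d) → ℝ≥0) :
    EuclideanSpace ℝ (Fin d) → ℝ≥0∞ :=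
  lconvolution (fun z => (γ z : ℝ≥0∞)) (fun z => (γ (-z) : ℝ≥0∞)) volume

/-- `(g, γ)` is an admissible pair: `g ∈ L²(ℝ)`, `γ` is a TSW on `ℝ²`, and `|V_g g|` is a TSW with
a controlling function `μ ∈ L²(γ ∗ Rγ)`. -/
structure IsAdmissiblePair (g : ℝ → ℂ) (γ : EuclideanSpace ℝ (Fin 2) → ℝ≥0) : Prop where
  memLp : MemLp g 2 volume
  isTSW : IsTSW γ
  exists_controlling : ∃ μ : EuclideanSpace ℝ (Fin 2) → ℝ≥0,
    IsTSWWith (fun z => ‖stft g g z‖₊) μ ∧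
      MemLp (fun z => (μ z : ℝ)) 2 (volume.withDensity (selfCorrelation γ))

/-- `u ∈ C_b^∞(ℝ^d)`: `u` is smooth, and `u` and all its derivatives are bounded. -/
def IsCbSmooth {d : ℕ} (u : EuclideanSpace ℝ (Fin d) → ℂ) : Prop :=
  ContDiff ℝ ∞ u ∧ ∀ n : ℕ, ∃ B : ℝ, ∀ x, ‖iteratedFDeriv ℝ n u x‖ ≤ B

/-- `‖∇u‖²_{L²(w)} = ∫ (∑ₗ |∂ₗ u(x)|²) w(x) dx`. -/
noncomputable def gradEnergy {d : ℕ} (u : EuclideanSpace ℝ (Fin d) → ℂ)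
    (w : EuclideanSpace ℝ (Fin d) → ℝ≥0∞) : ℝ≥0∞ :=
  ∫⁻ x, (∑ l : Fin d, ‖fderiv ℝ u x (EuclideanSpace.single l 1)‖ₑ ^ 2) * w x

/-- The Poincaré inequality for the pair of weights `v, w` holds with the constant `K`:
`inf_c ‖u - c‖²_{L²(v)} ≤ K ‖∇u‖²_{L²(w)}` for all `u ∈ C_b^∞`. -/
def PoincareWith {d : ℕ} (v w : EuclideanSpace ℝ (Fin d) → ℝ≥0∞) (K : ℝ≥0) : Prop :=
  ∀ u : EuclideanSpace ℝ (Fin d) → ℂ, IsCbSmooth u →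
    (⨅ c : ℂ, ∫⁻ x, ‖u x - c‖ₑ ^ 2 * v x) ≤ K * gradEnergy u w

/-- The Poincaré constant `C_P(v, w) ∈ [0, ∞]`; it is `∞` if `v, w` support no Poincaré
inequality. -/
noncomputable def poincareConst {d : ℕ} (v w : EuclideanSpace ℝ (Fin d) → ℝ≥0∞) : ℝ≥0∞ :=
  ⨅ (K : ℝ≥0) (_ : PoincareWith v w K), (K : ℝ≥0∞)

/-- The weighted mixed norm `‖F‖_{𝓛(χ)}`, i.e. the `L⁴(χ)`-norm of `τ ↦ ‖F‖_{L²(B₁(τ))}`. -/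
noncomputable def mixedNorm {d : ℕ} (χ : EuclideanSpace ℝ (Fin d) → ℝ≥0)
    (F : EuclideanSpace ℝ (Fin d) → ℂ) : ℝ≥0∞ :=
  (∫⁻ τ, eLpNorm F 2 (volume.restrict (Metric.ball τ 1)) ^ 4 * χ τ) ^ (1 / 4 : ℝ)

/-- The distance `𝔡(φ, ψ) = ‖φ² - ψ²‖_{L²}^{1/2}`. -/
noncomputable def phaselessDist {d : ℕ} (φ ψ : EuclideanSpace ℝ (Fin d) → ℝ) : ℝ≥0∞ :=
  eLpNorm (fun z => φ z ^ 2 - ψ z ^ 2) 2 volume ^ (1 / 2 : ℝ)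

/-- The weight `w = (|F|² ∗ γ)²`. -/
noncomputable def smoothedWeight {d : ℕ} (F : EuclideanSpace ℝ (Fin d) → ℂ)
    (γ : EuclideanSpace ℝ (Fin d) → ℝ≥0) (z : EuclideanSpace ℝ (Fin d)) : ℝ≥0∞ :=
  (lconvolution (fun y => ‖F y‖ₑ ^ 2) (fun y => (γ y : ℝ≥0∞)) volume z) ^ 2

/-!
Write `F = V_g f` and `H = V_g h`. The proof compares, on every unit ball, the rank one kernels
`F(x) conj (F(y))` and `H(x) conj (H(y))`; these do not see the unknown phase.

*Correlations.* The Fourier transform of `V_g f · conj (V_g' f)` is, up to a rotation of the plane,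
`conj (V_f f) · V_g g'` (`fourier_stft_mul_conj_stft`). Taking for `g'` the time-frequency shift of
`g` by `-τ`, one gets `|V_g g'(z)| = |V_g g(z + τ)| ≤ μ(τ) |V_g g(z)|`. By Plancherel's theorem, the
`L²`-distance of `F · conj F(· - τ)` and `H · conj H(· - τ)` is therefore at most
`μ(τ) ‖|F|² - |H|²‖` (`lintegral_correlation_sub_le`).

*Localization.* Let `ν_z` be the measure with density `γ(z - ·)`, let `a`, `b` be the squared norms
of `F`, `H` in `L²(ν_z)`, and let `P` be their inner product. The squared distance of the kernels in
`L²(ν_z × ν_z)` is `D(z) = a² + b² - 2|P|²` (`lintegral_enorm_kernel_sub`). Integrating it in `z`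
produces the weight `γ ∗ Rγ` in `τ = x - y`, so that
`∫ D ≤ ∫ μ² (γ ∗ Rγ) · ‖|F|² - |H|²‖²` (`lintegral_gramDefect_le`). Admissibility also forces `γ` to
be integrable (`lintegral_weight_lt_top`), which makes all local quantities finite.

*Synchronization.* The local phase `v = 2P / (a + b)` satisfies `|v| ≤ 1`. A Cauchy–Schwarz argument
(`norm_crossMass_mul_sub_le`) bounds `|v(y) - v(z)| (a + b)(z)` by a multiple of `D(z)^(1/2)` for
`|y - z| ≤ 1`. Hence the mollification `u` of `v` is in `C_b^∞`, and both `|u - v|² a²` and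
`|∇u|² a²` are bounded by multiples of `D`, where `a² = w` (`exists_testFunction`). For every
constant `c` with phase `λ`, the local distance of `H` and `λ F` to the fourth power is at most a
multiple of `D + |v - c|² a²` (`sqMass_sub_phaseOf_sq_le`). Integrating this against `χ` and
applying the Poincaré inequality to `u` gives the theorem. If `|F| = |H|`, then `D = 0` almost
everywhere, and the local estimate at a single point already shows that `H = λ F`
(`iInf_mixedNorm_eq_zero`).
-/

/-! ### Plancherel's theorem for integrable, square integrable functions -/

section Plancherel
open scoped FourierTransform SchwartzMap
variable {E : Type*} [NormedAddCommGroup E] [InnerProductSpace ℝ E] [FiniteDimensional ℝ E]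
  [MeasurableSpace E] [BorelSpace E]

/-- On `L¹ ∩ L²` the `L²`-Fourier transform is given by the Fourier integral: both represent
the same tempered distribution. -/
theorem fourier_toLp_ae_eq {φ : E → ℂ} (h1 : Integrable φ) (h2 : MemLp φ 2) :
    (𝓕 (h2.toLp φ) : Lp ℂ 2 (volume : Measure E)) =ᵐ[volume] 𝓕 φ := by
  have hc : Continuous (𝓕 φ) :=
    VectorFourier.fourierIntegral_continuous Real.continuous_fourierChar continuous_inner h1
  refine ae_eq_of_integral_contDiff_smul_eq
    ((Lp.memLp _).locallyIntegrable (by norm_num)) hc.locallyIntegrable ?_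
  intro ρ hρ hρc
  -- Both sides are tested against the Schwartz function `G = ρ`, with the Fourier transform moved
  -- onto `G`.
  let G : 𝓢(E, ℂ) := (hρc.comp_left (g := ((↑) : ℝ → ℂ)) (by simp)).toSchwartzMap
    (Complex.ofRealCLM.contDiff.comp hρ)
  have key := congrArg (fun T => T G) (Lp.fourier_toTemperedDistribution_eq (h2.toLp φ))
  simp only [TemperedDistribution.fourier_apply, Lp.toTemperedDistribution_apply] at key
  have e1 : ∀ x, (G x) = (ρ x : ℂ) := fun x => rfl
  have e2 : ∫ x, ρ x • (𝓕 (h2.toLp φ) : Lp ℂ 2 (volume : Measure E)) x =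
      ∫ x, G x • (𝓕 (h2.toLp φ) : Lp ℂ 2 (volume : Measure E)) x := by
    simp [e1]
  rw [e2, ← key]
  have e3 : ∫ x, (𝓕 G) x • (h2.toLp φ) x = ∫ x, (𝓕 (G : E → ℂ)) x • φ x := by
    refine integral_congr_ae ?_
    filter_upwards [h2.coeFn_toLp] with x hx
    rw [hx, SchwartzMap.fourier_coe]
  rw [e3]
  have := VectorFourier.integral_fourierIntegral_smul_eq_flip (μ := (volume : Measure E))
    (ν := volume) (L := innerₗ E) Real.continuous_fourierChar continuous_inner (G.integrable) h1
  simp only [flip_innerₗ] at this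
  refine this.trans ?_
  simp [e1]
  rfl

theorem eLpNorm_fourier_eq {φ : E → ℂ} (h1 : Integrable φ) (h2 : MemLp φ 2) :
    eLpNorm (𝓕 φ) 2 volume = eLpNorm φ 2 volume := by
  rw [← eLpNorm_congr_ae (fourier_toLp_ae_eq h1 h2), ← eLpNorm_congr_ae h2.coeFn_toLp,
    ← Lp.enorm_def, ← Lp.enorm_def, ← ofReal_norm, ← ofReal_norm,
    Lp.norm_fourier_eq]

/-- Parseval's identity on `L¹ ∩ L²`. -/
theorem integral_fourier_mul_conj_fourier {φ ψ : E → ℂ} (h1 : Integrable φ) (h2 : MemLp φ 2)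
    (k1 : Integrable ψ) (k2 : MemLp ψ 2) :
    ∫ x, 𝓕 φ x * conj (𝓕 ψ x) = ∫ x, φ x * conj (ψ x) := by
  have := Lp.inner_fourier_eq (k2.toLp ψ) (h2.toLp φ)
  rw [L2.inner_def, L2.inner_def] at this
  have e1 : ∫ x, 𝓕 φ x * conj (𝓕 ψ x) =
      ∫ x, inner ℂ ((𝓕 (k2.toLp ψ) : Lp ℂ 2 (volume : Measure E)) x)
        ((𝓕 (h2.toLp φ) : Lp ℂ 2 (volume : Measure E)) x) := by
    refine integral_congr_ae ?_
    filter_upwards [fourier_toLp_ae_eq h1 h2, fourier_toLp_ae_eq k1 k2] with x hx hy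
    rw [hx, hy]; rfl
  rw [e1, this]
  refine integral_congr_ae ?_
  filter_upwards [h2.coeFn_toLp, k2.coeFn_toLp] with x hx hy
  rw [hx, hy]; rfl
end Plancherel

/-! ### Integration over the time-frequency plane -/

section Plane

/-- The time-frequency plane, as a measurable space, is the product `ℝ × ℝ`. -/
noncomputable def planeEquiv : ℝ × ℝ ≃ᵐ EuclideanSpace ℝ (Fin 2) :=
  MeasurableEquiv.finTwoArrow.symm.trans (MeasurableEquiv.toLp 2 (Fin 2 → ℝ))

@[simp] theorem planeEquiv_apply_zero (p : ℝ × ℝ) : planeEquiv p 0 = p.1 := rfl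

@[simp] theorem planeEquiv_apply_one (p : ℝ × ℝ) : planeEquiv p 1 = p.2 := rfl

theorem measurePreserving_planeEquiv : MeasurePreserving planeEquiv :=
  ((volume_preserving_finTwoArrow ℝ).symm MeasurableEquiv.finTwoArrow).trans
    (PiLp.volume_preserving_toLp (Fin 2))

theorem lintegral_plane {G : EuclideanSpace ℝ (Fin 2) → ℝ≥0∞} (hG : Measurable G) :
    ∫⁻ z, G z = ∫⁻ x : ℝ, ∫⁻ ξ : ℝ, G (planeEquiv (x, ξ)) := by
  rw [← measurePreserving_planeEquiv.lintegral_comp hG]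
  exact lintegral_prod _ (hG.comp planeEquiv.measurable).aemeasurable

theorem integral_plane {G : EuclideanSpace ℝ (Fin 2) → ℂ} (hG : Integrable G) :
    ∫ z, G z = ∫ x : ℝ, ∫ ξ : ℝ, G (planeEquiv (x, ξ)) := by
  rw [← measurePreserving_planeEquiv.integral_comp' (g := G)]
  exact integral_prod _
    ((measurePreserving_planeEquiv.integrable_comp_emb planeEquiv.measurableEmbedding).2 hG)

end Plane

/-! ### The short-time Fourier transform and the Fourier transform of products -/

section STFT
open scoped FourierTransform

variable {f g f' g' : ℝ → ℂ}

@[fun_prop]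
theorem Measurable.complex_conj {α : Type*} [MeasurableSpace α] {u : α → ℂ} (hu : Measurable u) :
    Measurable fun x => conj (u x) :=
  Complex.continuous_conj.measurable.comp hu

theorem stft_congr (hf : f =ᵐ[volume] f') (hg : g =ᵐ[volume] g') : stft g f = stft g' f' := by
  funext z
  refine integral_congr_ae ?_
  have h2 : (fun t => g (t - z 0)) =ᵐ[volume] fun t => g' (t - z 0) :=
    (measurePreserving_sub_right volume (z 0)).quasiMeasurePreserving.ae_eq_comp hg
  filter_upwards [hf, h2] with t h1 h2
  simp only [h1, h2]

theorem stft_eq_fourier (z : EuclideanSpace ℝ (Fin 2)) :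
    stft g f z = 𝓕 (fun t => f t * conj (g (t - z 0))) (z 1) := by
  rw [stft, Real.fourier_real_eq_integral_exp_smul]
  refine integral_congr_ae (.of_forall fun t => ?_)
  simp only [smul_eq_mul]
  rw [mul_comm]
  congr 2
  push_cast
  ring

theorem measurable_stft (hf : Measurable f) (hg : Measurable g) : Measurable (stft g f) := by
  have : StronglyMeasurable (Function.uncurry fun (z : EuclideanSpace ℝ (Fin 2)) (t : ℝ) =>
      f t * conj (g (t - z 0)) * Complex.exp (-(2 * Real.pi * Complex.I * (z 1) * t))) := by
    refine Measurable.stronglyMeasurable ?_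
    have h0 : Measurable fun p : EuclideanSpace ℝ (Fin 2) × ℝ => p.1 0 := by fun_prop
    have h1 : Measurable fun p : EuclideanSpace ℝ (Fin 2) × ℝ => p.1 1 := by fun_prop
    simp only [Function.uncurry_def]
    fun_prop
  exact this.integral_prod_right.measurable

theorem MemLp.comp_sub_right {p : ℝ≥0∞} (hg : MemLp g p) (x : ℝ) :
    MemLp (fun t => g (t - x)) p :=
  hg.comp_measurePreserving (measurePreserving_sub_right volume x)

theorem memLp_conj {α : Type*} [MeasurableSpace α] {μ : Measure α} {p : ℝ≥0∞} {g : α → ℂ}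
    (hg : MemLp g p μ) : MemLp (fun t => conj (g t)) p μ := hg.star

theorem integrable_mul_conj_translate (hf : MemLp f 2) (hg : MemLp g 2) (x : ℝ) :
    Integrable fun t => f t * conj (g (t - x)) :=
  hf.integrable_mul (memLp_conj (MemLp.comp_sub_right hg x))

theorem enorm_stft_le (hf : MemLp f 2) (hg : MemLp g 2) (z : EuclideanSpace ℝ (Fin 2)) :
    ‖stft g f z‖ₑ ≤ eLpNorm f 2 volume * eLpNorm g 2 volume := by
  refine (enorm_integral_le_lintegral_enorm _).trans ?_
  have h := eLpNorm_smul_le_mul_eLpNorm (p := 2) (q := 2) (r := 1) (μ := (volume : Measure ℝ))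
    (memLp_conj (MemLp.comp_sub_right hg (z 0))).1 hf.1
  have h2 : eLpNorm (fun t => conj (g (t - z 0))) 2 volume = eLpNorm g 2 volume := by
    rw [← eLpNorm_comp_measurePreserving hg.1 (measurePreserving_sub_right volume (z 0))]
    refine eLpNorm_congr_norm_ae (.of_forall fun t => ?_)
    simp
  rw [h2, eLpNorm_one_eq_lintegral_enorm] at h
  refine le_trans (le_of_eq (lintegral_congr fun t => ?_)) h
  have : ‖Complex.exp (-(2 * Real.pi * Complex.I * (z 1) * t))‖ₑ = 1 := by
    rw [← ofReal_norm, Complex.norm_exp]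
    simp
  simp [enorm_mul, this]

theorem lintegral_enorm_sq_translate (hf : Measurable f) (hg : Measurable g) :
    ∫⁻ x : ℝ, ∫⁻ t : ℝ, ‖f t * conj (g (t - x))‖ₑ ^ 2
      = (∫⁻ t, ‖f t‖ₑ ^ 2) * ∫⁻ t, ‖g t‖ₑ ^ 2 := by
  rw [lintegral_lintegral_swap (Measurable.aemeasurable
    (f := fun p : ℝ × ℝ => ‖f p.2 * conj (g (p.2 - p.1))‖ₑ ^ 2) (by fun_prop))]
  have h1 : ∀ t, ∫⁻ x : ℝ, ‖f t * conj (g (t - x))‖ₑ ^ 2 = ‖f t‖ₑ ^ 2 * ∫⁻ t, ‖g t‖ₑ ^ 2 := by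
    intro t
    simp only [enorm_mul, mul_pow, RCLike.enorm_conj]
    rw [lintegral_const_mul _ (by fun_prop), lintegral_sub_left_eq_self (fun s => ‖g s‖ₑ ^ 2)]
  simp only [h1]
  rw [lintegral_mul_const _ (by fun_prop)]

theorem lintegral_enorm_sq_lt_top {α : Type*} [MeasurableSpace α] {μ : Measure α} {f : α → ℂ}
    (hf : MemLp f 2 μ) : ∫⁻ t, ‖f t‖ₑ ^ 2 ∂μ < ⊤ := by
  have := (eLpNorm_lt_top_iff_lintegral_rpow_enorm_lt_top (by norm_num) (by norm_num)).1 hf.2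
  simpa using this

theorem memLp_two_of_lintegral {α : Type*} [MeasurableSpace α] {μ : Measure α} {f : α → ℂ}
    (hm : AEStronglyMeasurable f μ) (hf : ∫⁻ t, ‖f t‖ₑ ^ 2 ∂μ < ⊤) : MemLp f 2 μ := by
  refine ⟨hm, (eLpNorm_lt_top_iff_lintegral_rpow_enorm_lt_top (by norm_num) (by norm_num)).2 ?_⟩
  simpa using hf

theorem eLpNorm_two_sq {α : Type*} [MeasurableSpace α] (μ : Measure α) (f : α → ℂ) :
    eLpNorm f 2 μ ^ 2 = ∫⁻ t, ‖f t‖ₑ ^ 2 ∂μ := by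
  rw [eLpNorm_eq_lintegral_rpow_enorm_toReal (by norm_num) (by norm_num)]
  simp only [ENNReal.toReal_ofNat, ENNReal.rpow_ofNat, one_div]
  rw [← ENNReal.rpow_natCast, ← ENNReal.rpow_mul]
  simp

/-- For almost every `x`, the product `f · conj (g (· - x))` of square integrable functions is
square integrable. -/
theorem ae_memLp_mul_conj_translate (hfm : Measurable f) (hgm : Measurable g) (hf : MemLp f 2)
    (hg : MemLp g 2) : ∀ᵐ x : ℝ, MemLp (fun t => f t * conj (g (t - x))) 2 := by
  have h := lintegral_enorm_sq_translate hfm hgm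
  have hm : Measurable fun x : ℝ => ∫⁻ t : ℝ, ‖f t * conj (g (t - x))‖ₑ ^ 2 :=
    Measurable.lintegral_prod_right' (f := fun p : ℝ × ℝ => ‖f p.2 * conj (g (p.2 - p.1))‖ₑ ^ 2)
      (by fun_prop)
  have h2 := ae_lt_top hm (by
    rw [h]
    exact (ENNReal.mul_lt_top (lintegral_enorm_sq_lt_top hf) (lintegral_enorm_sq_lt_top hg)).ne)
  filter_upwards [h2] with x hx
  exact memLp_two_of_lintegral
    (Measurable.aestronglyMeasurable (by fun_prop)) hx

/-- The short-time Fourier transform maps into `L²`, by Plancherel's theorem in the frequency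
variable. -/
theorem memLp_stft (hfm : Measurable f) (hgm : Measurable g) (hf : MemLp f 2) (hg : MemLp g 2) :
    MemLp (stft g f) 2 := by
  refine memLp_two_of_lintegral (measurable_stft hfm hgm).aestronglyMeasurable ?_
  rw [lintegral_plane ((measurable_stft hfm hgm).enorm.pow_const 2)]
  refine lt_of_le_of_lt (lintegral_mono_ae ?_)
    (lt_of_eq_of_lt (lintegral_enorm_sq_translate hfm hgm)
      (ENNReal.mul_lt_top (lintegral_enorm_sq_lt_top hf) (lintegral_enorm_sq_lt_top hg)))
  filter_upwards [ae_memLp_mul_conj_translate hfm hgm hf hg] with x hx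
  have := eLpNorm_fourier_eq (integrable_mul_conj_translate hf hg x) hx
  rw [← eLpNorm_two_sq volume (fun t => f t * conj (g (t - x))), ← this, eLpNorm_two_sq]
  simp [stft_eq_fourier]

theorem fourier_translate (φ : ℝ → ℂ) (b ξ : ℝ) :
    𝓕 (fun t => φ (t - b)) ξ = Complex.exp (-(2 * Real.pi * Complex.I * b * ξ)) * 𝓕 φ ξ := by
  rw [Real.fourier_real_eq_integral_exp_smul, Real.fourier_real_eq_integral_exp_smul,
    ← integral_const_mul,
    ← integral_add_right_eq_self (fun t =>
      Complex.exp (↑(-2 * Real.pi * t * ξ) * Complex.I) • φ (t - b)) b]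
  refine integral_congr_ae (.of_forall fun t => ?_)
  simp only [smul_eq_mul, add_sub_cancel_right]
  rw [← mul_assoc, ← Complex.exp_add]
  congr 2
  push_cast
  ring

/-- The Fourier transform of a product of two STFTs factorizes into STFTs of the signals and of the
windows, evaluated at a rotated point. -/
theorem fourier_stft_mul_conj_stft (hfm : Measurable f) (hgm : Measurable g)
    (hfm' : Measurable f') (hgm' : Measurable g') (hf : MemLp f 2) (hg : MemLp g 2)
    (hf' : MemLp f' 2) (hg' : MemLp g' 2) (w : EuclideanSpace ℝ (Fin 2)) :
    𝓕 (fun z => stft g f z * conj (stft g' f' z)) w =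
      conj (stft f f' (planeEquiv (w 1, -w 0))) * stft g g' (planeEquiv (w 1, -w 0)) := by
  have hint : Integrable fun z => stft g f z * conj (stft g' f' z) :=
    (memLp_stft hfm hgm hf hg).integrable_mul (memLp_conj (memLp_stft hfm' hgm' hf' hg'))
  have hint' : Integrable fun z : EuclideanSpace ℝ (Fin 2) =>
      Complex.exp (↑(-2 * Real.pi * inner ℝ z w) * Complex.I) •
        (stft g f z * conj (stft g' f' z)) := by
    refine hint.bdd_mul (c := 1) (by fun_prop) (.of_forall fun z => ?_)
    rw [Complex.norm_exp_ofReal_mul_I]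
  rw [Real.fourier_eq', integral_plane hint']
  -- The integral over the frequency, by Parseval's identity on the time axis.
  have hx : ∀ᵐ x : ℝ, ∫ ξ : ℝ,
      Complex.exp (↑(-2 * Real.pi * inner ℝ (planeEquiv (x, ξ)) w) * Complex.I) •
        (stft g f (planeEquiv (x, ξ)) * conj (stft g' f' (planeEquiv (x, ξ)))) =
      ∫ t : ℝ, (f (t - w 1) * conj (f' t) * Complex.exp (-(2 * Real.pi * Complex.I * (w 0) * t))) *
        (conj (g (t - x - w 1)) * g' (t - x) *
          Complex.exp ((2 * Real.pi * Complex.I * (w 0) * ↑(t - x)))) := by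
    filter_upwards [ae_memLp_mul_conj_translate hfm hgm hf hg,
      ae_memLp_mul_conj_translate hfm' hgm' hf' hg'] with x h1 h2
    have e := integral_fourier_mul_conj_fourier
      ((integrable_mul_conj_translate hf hg x).comp_sub_right (w 1))
      (MemLp.comp_sub_right h1 (w 1)) (integrable_mul_conj_translate hf' hg' x) h2
    have e1 : ∀ ξ : ℝ, Complex.exp (↑(-2 * Real.pi * inner ℝ (planeEquiv (x, ξ)) w) * Complex.I) •
        (stft g f (planeEquiv (x, ξ)) * conj (stft g' f' (planeEquiv (x, ξ)))) =
        Complex.exp (-(2 * Real.pi * Complex.I * (w 0) * x)) *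
        (𝓕 (fun t => f (t - w 1) * conj (g (t - w 1 - x))) ξ *
          conj (𝓕 (fun t => f' t * conj (g' (t - x))) ξ)) := by
      intro ξ
      rw [fourier_translate (fun t => f t * conj (g (t - x))), stft_eq_fourier, stft_eq_fourier]
      simp only [planeEquiv_apply_zero, planeEquiv_apply_one, smul_eq_mul]
      rw [← mul_assoc, ← mul_assoc, ← mul_assoc, ← Complex.exp_add]
      congr 3
      rw [PiLp.inner_apply]
      simp [Fin.sum_univ_two]
      ring
    simp only [e1]
    rw [integral_const_mul, e, ← integral_const_mul]
    refine integral_congr_ae (.of_forall fun t => ?_)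
    have e3 : Complex.exp (-(2 * Real.pi * Complex.I * (w 0) * x)) =
        Complex.exp (-(2 * Real.pi * Complex.I * (w 0) * t)) *
          Complex.exp ((2 * Real.pi * Complex.I * (w 0) * ↑(t - x))) := by
      rw [← Complex.exp_add]; congr 1; push_cast; ring
    have e4 : t - w 1 - x = t - x - w 1 := by ring
    simp only [e3, e4, map_mul, Complex.conj_conj]
    ring
  rw [integral_congr_ae hx]
  have hbdd : ∀ t : ℝ, ‖Complex.exp (-(2 * Real.pi * Complex.I * (w 0) * t))‖ = 1 := by
    intro t; rw [Complex.norm_exp]; simp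
  have hbdd' : ∀ t : ℝ, ‖Complex.exp ((2 * Real.pi * Complex.I * (w 0) * t))‖ = 1 := by
    intro t; rw [Complex.norm_exp]; simp
  have hA : Integrable fun t : ℝ => f (t - w 1) * conj (f' t) *
      Complex.exp (-(2 * Real.pi * Complex.I * (w 0) * t)) :=
    ((MemLp.comp_sub_right hf (w 1)).integrable_mul (memLp_conj hf')).mul_bdd (c := 1)
      (by fun_prop) (.of_forall fun t => (hbdd t).le)
  have hB : Integrable fun s : ℝ => conj (g (s - w 1)) * g' s *
      Complex.exp ((2 * Real.pi * Complex.I * (w 0) * s)) :=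
    ((memLp_conj (MemLp.comp_sub_right hg (w 1))).integrable_mul hg').mul_bdd (c := 1)
      (by fun_prop) (.of_forall fun t => (hbdd' t).le)
  -- In the variables `t` and `s = t - x` the integrand is a product.
  have hprod := hA.convolution_integrand (ContinuousLinearMap.mul ℝ ℂ) hB.comp_neg
  rw [integral_integral_swap (by
    refine hprod.congr (.of_forall fun p => ?_)
    simp [Function.uncurry_def])]
  have e5 : ∀ t : ℝ, ∫ x : ℝ, (f (t - w 1) * conj (f' t) *
        Complex.exp (-(2 * Real.pi * Complex.I * (w 0) * t))) *
        (conj (g (t - x - w 1)) * g' (t - x) *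
          Complex.exp ((2 * Real.pi * Complex.I * (w 0) * ↑(t - x)))) =
      (f (t - w 1) * conj (f' t) * Complex.exp (-(2 * Real.pi * Complex.I * (w 0) * t))) *
        ∫ s : ℝ, conj (g (s - w 1)) * g' s *
          Complex.exp ((2 * Real.pi * Complex.I * (w 0) * s)) := by
    intro t
    rw [integral_const_mul, integral_sub_left_eq_self (fun s : ℝ => conj (g (s - w 1)) * g' s *
          Complex.exp ((2 * Real.pi * Complex.I * (w 0) * s)))]
  simp only [e5]
  rw [integral_mul_const, stft, stft, ← integral_conj]
  congr 1
  · refine integral_congr_ae (.of_forall fun t => ?_)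
    simp only [planeEquiv_apply_zero, planeEquiv_apply_one, map_mul, Complex.conj_conj,
      ← Complex.exp_conj]
    simp [map_ofNat]
    ring
  · refine integral_congr_ae (.of_forall fun t => ?_)
    simp
    ring

end STFT

/-! ### Correlations of short-time Fourier transforms -/

section TranslateEstimate
open scoped FourierTransform

variable {f g h : ℝ → ℂ}

/-- The time-frequency shift of `g` by `-τ`, for `τ` a point of the plane. -/
noncomputable def timeFreqShift (τ : EuclideanSpace ℝ (Fin 2)) (g : ℝ → ℂ) (s : ℝ) : ℂ :=
  Complex.exp (-(2 * Real.pi * Complex.I * (τ 1) * s)) * g (s + τ 0)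

theorem measurable_timeFreqShift (τ : EuclideanSpace ℝ (Fin 2)) (hg : Measurable g) :
    Measurable (timeFreqShift τ g) := by
  unfold timeFreqShift; fun_prop

theorem memLp_timeFreqShift (τ : EuclideanSpace ℝ (Fin 2)) (hgm : Measurable g)
    (hg : MemLp g 2) : MemLp (timeFreqShift τ g) 2 := by
  have h1 : MemLp (fun s => g (s + τ 0)) 2 :=
    hg.comp_measurePreserving (measurePreserving_add_right volume (τ 0))
  refine (memLp_congr_norm h1.1 (measurable_timeFreqShift τ hgm).aestronglyMeasurable
    (.of_forall fun s => ?_)).1 h1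
  simp [timeFreqShift, Complex.norm_exp]

theorem stft_timeFreqShift_window (τ z : EuclideanSpace ℝ (Fin 2)) :
    stft (timeFreqShift τ g) f z =
      Complex.exp (-(2 * Real.pi * Complex.I * (τ 1) * (z 0))) * stft g f (z - τ) := by
  rw [stft, stft, ← integral_const_mul]
  refine integral_congr_ae (.of_forall fun t => ?_)
  have e : t - (z - τ) 0 = t - z 0 + τ 0 := by simp; ring
  simp only [e, timeFreqShift, map_mul, ← Complex.exp_conj]
  have e2 : Complex.exp (conj (-(2 * Real.pi * Complex.I * (τ 1) * ↑(t - z 0)))) *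
      Complex.exp (-(2 * Real.pi * Complex.I * (z 1) * t)) =
      Complex.exp (-(2 * Real.pi * Complex.I * (τ 1) * (z 0))) *
      Complex.exp (-(2 * Real.pi * Complex.I * ↑((z - τ) 1) * t)) := by
    rw [← Complex.exp_add, ← Complex.exp_add]
    congr 1
    simp [map_ofNat]
    ring
  linear_combination (f t * conj (g (t - z 0 + τ 0))) * e2

theorem enorm_stft_timeFreqShift (τ z : EuclideanSpace ℝ (Fin 2)) :
    ‖stft g (timeFreqShift τ g) z‖ₑ = ‖stft g g (z + τ)‖ₑ := by
  have : stft g (timeFreqShift τ g) z =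
      Complex.exp (2 * Real.pi * Complex.I * (z 1 + τ 1) * τ 0) * stft g g (z + τ) := by
    rw [stft, stft, ← integral_const_mul, ← integral_sub_right_eq_self _ (τ 0)]
    refine integral_congr_ae (.of_forall fun t => ?_)
    have e : t - (z + τ) 0 = t - τ 0 - z 0 := by simp; ring
    simp only [e, timeFreqShift, sub_add_cancel]
    have e2 : Complex.exp (-(2 * Real.pi * Complex.I * (τ 1) * ↑(t - τ 0))) *
        Complex.exp (-(2 * Real.pi * Complex.I * (z 1) * ↑(t - τ 0))) =
        Complex.exp (2 * Real.pi * Complex.I * (z 1 + τ 1) * τ 0) *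
        Complex.exp (-(2 * Real.pi * Complex.I * ↑((z + τ) 1) * t)) := by
      rw [← Complex.exp_add, ← Complex.exp_add]
      congr 1
      simp
      ring
    linear_combination (g t * conj (g (t - τ 0 - z 0))) * e2
  rw [this, enorm_mul]
  have : ‖Complex.exp (2 * Real.pi * Complex.I * (z 1 + τ 1) * τ 0)‖ₑ = 1 := by
    rw [← ofReal_norm, Complex.norm_exp]
    simp
  rw [this, one_mul]

theorem memLp_mul_of_bdd {α : Type*} [MeasurableSpace α] {μ : Measure α} {u v : α → ℂ} {B : ℝ≥0∞}
    (hB : B ≠ ⊤) (hu : Measurable u) (hub : ∀ x, ‖u x‖ₑ ≤ B) (hv : MemLp v 2 μ) :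
    MemLp (fun x => u x * v x) 2 μ := by
  refine hv.of_le_mul (c := B.toReal) (hu.aestronglyMeasurable.mul hv.1) (.of_forall fun x => ?_)
  rw [norm_mul]
  gcongr
  rw [← toReal_enorm]
  exact ENNReal.toReal_mono hB (hub x)

theorem integrable_stft_mul (hfm : Measurable f) (hgm : Measurable g) (hf : MemLp f 2)
    (hg : MemLp g 2) {g' : ℝ → ℂ} (hgm' : Measurable g') (hg' : MemLp g' 2) :
    Integrable fun z => stft g f z * conj (stft g' f z) :=
  (memLp_stft hfm hgm hf hg).integrable_mul (memLp_conj (memLp_stft hfm hgm' hf hg'))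

theorem memLp_stft_mul (hfm : Measurable f) (hgm : Measurable g) (hf : MemLp f 2)
    (hg : MemLp g 2) {g' : ℝ → ℂ} (hgm' : Measurable g') (hg' : MemLp g' 2) :
    MemLp (fun z => stft g f z * conj (stft g' f z)) 2 :=
  memLp_mul_of_bdd (ENNReal.mul_lt_top hf.2 hg.2).ne (measurable_stft hfm hgm)
    (enorm_stft_le hf hg) (memLp_conj (memLp_stft hfm hgm' hf hg'))

theorem fourier_stft_sub (hfm : Measurable f) (hgm : Measurable g) (hhm : Measurable h)
    (hf : MemLp f 2) (hg : MemLp g 2) (hh : MemLp h 2) {g' : ℝ → ℂ} (hgm' : Measurable g')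
    (hg' : MemLp g' 2) (w : EuclideanSpace ℝ (Fin 2)) :
    𝓕 (fun z => stft g f z * conj (stft g' f z) - stft g h z * conj (stft g' h z)) w =
      (conj (stft f f (planeEquiv (w 1, -w 0))) - conj (stft h h (planeEquiv (w 1, -w 0)))) *
        stft g g' (planeEquiv (w 1, -w 0)) := by
  rw [sub_mul, ← fourier_stft_mul_conj_stft hfm hgm hfm hgm' hf hg hf hg',
    ← fourier_stft_mul_conj_stft hhm hgm hhm hgm' hh hg hh hg', Real.fourier_eq, Real.fourier_eq,
    Real.fourier_eq, ← integral_sub]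
  · simp [smul_sub]
  · exact (Real.fourierIntegral_convergent_iff w).2 (integrable_stft_mul hfm hgm hf hg hgm' hg')
  · exact (Real.fourierIntegral_convergent_iff w).2 (integrable_stft_mul hhm hgm hh hg hgm' hg')

theorem eLpNorm_fourier_stft_sub (hfm : Measurable f) (hgm : Measurable g) (hhm : Measurable h)
    (hf : MemLp f 2) (hg : MemLp g 2) (hh : MemLp h 2) {g' : ℝ → ℂ} (hgm' : Measurable g')
    (hg' : MemLp g' 2) :
    eLpNorm (𝓕 fun z => stft g f z * conj (stft g' f z) - stft g h z * conj (stft g' h z)) 2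
        volume =
      eLpNorm (fun z => stft g f z * conj (stft g' f z) - stft g h z * conj (stft g' h z)) 2
        volume :=
  eLpNorm_fourier_eq
    ((integrable_stft_mul hfm hgm hf hg hgm' hg').sub (integrable_stft_mul hhm hgm hh hg hgm' hg'))
    ((memLp_stft_mul hfm hgm hf hg hgm' hg').sub (memLp_stft_mul hhm hgm hh hg hgm' hg'))

/-- Translation stability of the ambiguity function `V_g g` controls the correlations of two STFTs
at distance `τ` by their spectrograms: on the Fourier side both sides carry the same factor
`conj (V_f f - V_h h)`, times `V_g g(· + τ)` (up to a phase) and `V_g g`, respectively. -/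
theorem lintegral_correlation_sub_le (hfm : Measurable f) (hgm : Measurable g)
    (hhm : Measurable h) (hf : MemLp f 2) (hg : MemLp g 2) (hh : MemLp h 2)
    {τ : EuclideanSpace ℝ (Fin 2)} {m : ℝ≥0}
    (hm : ∀ z, ‖stft g g (z + τ)‖ₑ ≤ m * ‖stft g g z‖ₑ) :
    ∫⁻ z, ‖stft g f z * conj (stft g f (z - τ)) - stft g h z * conj (stft g h (z - τ))‖ₑ ^ 2 ≤
      m ^ 2 * ∫⁻ z, ‖stft g f z * conj (stft g f z) - stft g h z * conj (stft g h z)‖ₑ ^ 2 := by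
  have hgm' := measurable_timeFreqShift τ hgm
  have hg' := memLp_timeFreqShift τ hgm hg
  have e1 : ∀ z, ‖stft g f z * conj (stft g f (z - τ)) - stft g h z * conj (stft g h (z - τ))‖ₑ =
      ‖stft g f z * conj (stft (timeFreqShift τ g) f z) -
        stft g h z * conj (stft (timeFreqShift τ g) h z)‖ₑ := by
    intro z
    simp only [stft_timeFreqShift_window, map_mul]
    set e := Complex.exp (-(2 * Real.pi * Complex.I * (τ 1) * (z 0)))
    have he : ‖conj e‖ₑ = 1 := by
      rw [RCLike.enorm_conj, ← ofReal_norm, Complex.norm_exp]; simp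
    rw [← one_mul ‖stft g f z * conj (stft g f (z - τ)) - _‖ₑ, ← he, ← enorm_mul]
    congr 1
    ring
  simp only [e1]
  rw [← eLpNorm_two_sq, ← eLpNorm_two_sq, ← eLpNorm_fourier_stft_sub hfm hgm hhm hf hg hh hgm' hg',
    ← eLpNorm_fourier_stft_sub hfm hgm hhm hf hg hh hgm hg, ← mul_pow]
  gcongr
  refine (eLpNorm_le_nnreal_smul_eLpNorm_of_ae_le_mul (c := m) (.of_forall fun w => ?_) 2).trans
    (le_of_eq (by rw [ENNReal.smul_def, smul_eq_mul]))
  have l1 := fourier_stft_sub hfm hgm hhm hf hg hh hgm' hg' w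
  have l2 := fourier_stft_sub hfm hgm hhm hf hg hh hgm hg w
  have key : ‖𝓕 (fun z => stft g f z * conj (stft (timeFreqShift τ g) f z) -
        stft g h z * conj (stft (timeFreqShift τ g) h z)) w‖ₑ ≤
      m * ‖𝓕 (fun z => stft g f z * conj (stft g f z) - stft g h z * conj (stft g h z)) w‖ₑ := by
    rw [l1, l2, enorm_mul, enorm_mul, enorm_stft_timeFreqShift, mul_left_comm]
    gcongr
    exact hm _
  exact ENNReal.coe_le_coe.1 (by rw [ENNReal.coe_mul]; exact key)

end TranslateEstimate

/-! ### A Gram matrix inequality in inner product spaces -/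

section Hilbert
open scoped ComplexInnerProductSpace

variable {E : Type*} [NormedAddCommGroup E] [InnerProductSpace ℂ E]

theorem norm_sq_smul_sub_inner_smul (F H : E) :
    ‖((‖F‖ ^ 2 : ℝ) : ℂ) • H - ⟪F, H⟫ • F‖ ^ 2 =
      ‖F‖ ^ 2 * (‖F‖ ^ 2 * ‖H‖ ^ 2 - ‖⟪F, H⟫‖ ^ 2) := by
  have hF : ⟪F, F⟫ = ((‖F‖ ^ 2 : ℝ) : ℂ) := by
    rw [inner_self_eq_norm_sq_to_K]; push_cast; rfl
  have h : ⟪((‖F‖ ^ 2 : ℝ) : ℂ) • H, ⟪F, H⟫ • F⟫ = ((‖F‖ ^ 2 * ‖⟪F, H⟫‖ ^ 2 : ℝ) : ℂ) := by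
    rw [inner_smul_left, inner_smul_right, Complex.conj_ofReal, ← inner_conj_symm H F,
      Complex.mul_conj, Complex.normSq_eq_norm_sq]
    push_cast; ring
  rw [@norm_sub_sq ℂ, h, norm_smul, norm_smul, Complex.norm_real]
  simp only [RCLike.re_to_complex, Complex.ofReal_re, norm_pow, norm_norm]
  ring

/-- The inequality behind the oscillation estimate for local phases; `F'` and `H'` are to be thought
of as `β F` and `β H` for an operator `β` of norm at most `B`. Inside the norm on the left stands
`⟪F', ‖F‖² H - ⟪F, H⟫ F⟫ + ⟪‖H‖² F' - ⟪H, F⟫ H', H⟫`, and the Gram determinant gives the norms of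
`‖F‖² H - ⟪F, H⟫ F` and `‖H‖² F - ⟪H, F⟫ H`. -/
theorem norm_inner_mul_sub_inner_mul_le {F H F' H' : E} {B : ℝ} (h1 : ‖F'‖ ≤ B * ‖F‖)
    (h2 : ‖((‖H‖ ^ 2 : ℝ) : ℂ) • F' - ⟪H, F⟫ • H'‖ ≤
      B * ‖((‖H‖ ^ 2 : ℝ) : ℂ) • F - ⟪H, F⟫ • H‖) :
    ‖⟪F', H⟫ * ((‖F‖ ^ 2 + ‖H‖ ^ 2 : ℝ) : ℂ) - ⟪F, H⟫ * (⟪F', F⟫ + ⟪H', H⟫)‖ ≤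
      B * (‖F‖ ^ 2 + ‖H‖ ^ 2) * √(‖F‖ ^ 2 * ‖H‖ ^ 2 - ‖⟪F, H⟫‖ ^ 2) := by
  set G := ‖F‖ ^ 2 * ‖H‖ ^ 2 - ‖⟪F, H⟫‖ ^ 2 with hG
  have e1 : ‖((‖F‖ ^ 2 : ℝ) : ℂ) • H - ⟪F, H⟫ • F‖ = ‖F‖ * √G := by
    rw [← Real.sqrt_sq (norm_nonneg (_ - _)), norm_sq_smul_sub_inner_smul, ← hG,
      Real.sqrt_mul (by positivity), Real.sqrt_sq (norm_nonneg _)]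
  have e2 : ‖((‖H‖ ^ 2 : ℝ) : ℂ) • F - ⟪H, F⟫ • H‖ = ‖H‖ * √G := by
    rw [← Real.sqrt_sq (norm_nonneg (_ - _)), norm_sq_smul_sub_inner_smul, norm_inner_symm,
      mul_comm (‖H‖ ^ 2) (‖F‖ ^ 2), ← hG, Real.sqrt_mul (by positivity),
      Real.sqrt_sq (norm_nonneg _)]
  have e : ⟪F', H⟫ * ((‖F‖ ^ 2 + ‖H‖ ^ 2 : ℝ) : ℂ) - ⟪F, H⟫ * (⟪F', F⟫ + ⟪H', H⟫) =
      ⟪F', ((‖F‖ ^ 2 : ℝ) : ℂ) • H - ⟪F, H⟫ • F⟫ +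
        ⟪((‖H‖ ^ 2 : ℝ) : ℂ) • F' - ⟪H, F⟫ • H', H⟫ := by
    rw [inner_sub_right, inner_sub_left, inner_smul_right, inner_smul_right, inner_smul_left,
      inner_smul_left, Complex.conj_ofReal, inner_conj_symm]
    push_cast
    ring
  rw [e]
  refine (norm_add_le _ _).trans ?_
  have i1 := norm_inner_le_norm (𝕜 := ℂ) F' (((‖F‖ ^ 2 : ℝ) : ℂ) • H - ⟪F, H⟫ • F)
  have i2 := norm_inner_le_norm (𝕜 := ℂ) (((‖H‖ ^ 2 : ℝ) : ℂ) • F' - ⟪H, F⟫ • H') H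
  rw [e1] at i1
  rw [e2] at h2
  have i3 : ‖F'‖ * (‖F‖ * √G) ≤ B * ‖F‖ * (‖F‖ * √G) := by gcongr
  have i4 := mul_le_mul_of_nonneg_right h2 (norm_nonneg H)
  nlinarith

end Hilbert

/-! ### Two functions in `L²(ν)` and their local phase -/

section GramMatrix
variable {α : Type*} [MeasurableSpace α] {ν : Measure α} {F H : α → ℂ}

/-- The squared `L²`-norm of `F`. -/
noncomputable def sqMass (ν : Measure α) (F : α → ℂ) : ℝ := ∫ x, ‖F x‖ ^ 2 ∂ν

/-- The `L²`-inner product `⟨F, H⟩`, conjugate-linear in `F`. -/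
noncomputable def crossMass (ν : Measure α) (F H : α → ℂ) : ℂ := ∫ x, conj (F x) * H x ∂ν

/-- The squared `L²`-distance of the rank one kernels `F(x) conj (F(y))` and `H(x) conj (H(y))`,
written in terms of the Gram matrix of `F` and `H`; see `lintegral_enorm_kernel_sub`. -/
noncomputable def gramDefect (ν : Measure α) (F H : α → ℂ) : ℝ :=
  sqMass ν F ^ 2 + sqMass ν H ^ 2 - 2 * ‖crossMass ν F H‖ ^ 2

theorem sqMass_nonneg (ν : Measure α) (F : α → ℂ) : 0 ≤ sqMass ν F :=
  integral_nonneg fun _ => by positivity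

theorem integrable_norm_sq (hF : MemLp F 2 ν) : Integrable (fun x => ‖F x‖ ^ 2) ν :=
  hF.integrable_norm_pow (by norm_num)

theorem integrable_conj_mul (hF : MemLp F 2 ν) (hH : MemLp H 2 ν) :
    Integrable (fun x => conj (F x) * H x) ν :=
  (memLp_conj hF).integrable_mul hH

theorem sqMass_eq_norm_toLp (hF : MemLp F 2 ν) : sqMass ν F = ‖hF.toLp F‖ ^ 2 := by
  have h : inner ℂ (hF.toLp F) (hF.toLp F) = ((sqMass ν F : ℝ) : ℂ) := by
    rw [L2.inner_def, sqMass, ← integral_complex_ofReal]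
    refine integral_congr_ae ?_
    filter_upwards [hF.coeFn_toLp] with x hx
    rw [hx, inner_self_eq_norm_sq_to_K]
    push_cast; rfl
  rw [inner_self_eq_norm_sq_to_K] at h
  apply Complex.ofReal_injective
  rw [← h]
  push_cast
  rfl

theorem crossMass_eq_inner (hF : MemLp F 2 ν) (hH : MemLp H 2 ν) :
    crossMass ν F H = inner ℂ (hF.toLp F) (hH.toLp H) := by
  rw [L2.inner_def, crossMass]
  refine integral_congr_ae ?_
  filter_upwards [hF.coeFn_toLp, hH.coeFn_toLp] with x hx hy
  rw [hx, hy, RCLike.inner_apply, mul_comm]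

theorem norm_crossMass_sq_le (hF : MemLp F 2 ν) (hH : MemLp H 2 ν) :
    ‖crossMass ν F H‖ ^ 2 ≤ sqMass ν F * sqMass ν H := by
  rw [crossMass_eq_inner hF hH, sqMass_eq_norm_toLp hF, sqMass_eq_norm_toLp hH, ← mul_pow]
  gcongr
  exact norm_inner_le_norm _ _

theorem sqMass_sub_smul (hF : MemLp F 2 ν) (hH : MemLp H 2 ν) (c : Circle) :
    sqMass ν (fun x => H x - c * F x) =
      sqMass ν F + sqMass ν H - 2 * (conj (c : ℂ) * crossMass ν F H).re := by
  have h : MemLp (fun x => H x - c * F x) 2 ν := hH.sub (hF.const_mul _)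
  have e : h.toLp _ = hH.toLp H - (c : ℂ) • hF.toLp F := by
    rw [← MemLp.toLp_const_smul, ← MemLp.toLp_sub]; rfl
  rw [sqMass_eq_norm_toLp h, e, sqMass_eq_norm_toLp hF, sqMass_eq_norm_toLp hH, @norm_sub_sq ℂ,
    norm_smul, inner_smul_right, crossMass_eq_inner hF hH]
  simp only [Circle.norm_coe, one_mul, RCLike.re_to_complex]
  rw [← inner_conj_symm, ← Complex.conj_re, map_mul, Complex.conj_conj]
  ring

theorem norm_toLp_mul_le {β : α → ℝ≥0} {B : ℝ≥0} (hB : ∀ x, β x ≤ B) {G K : α → ℂ}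
    (hG : MemLp G 2 ν) (hK : MemLp K 2 ν) (h : ∀ x, K x = (β x : ℂ) * G x) :
    ‖hK.toLp K‖ ≤ B * ‖hG.toLp G‖ := by
  refine Lp.norm_le_mul_norm_of_ae_le_mul ?_
  filter_upwards [hG.coeFn_toLp, hK.coeFn_toLp] with x hx hy
  rw [hx, hy, h x, norm_mul]
  gcongr
  simpa using hB x

/-- If the measure `ν` is multiplied by a density `β ≤ B`, then the normalized inner product of `F`
and `H` changes by an amount controlled by the failure of the Cauchy–Schwarz equality. -/
theorem norm_crossMass_mul_sub_le {β : α → ℝ≥0} {B : ℝ≥0} (hβ : Measurable β) (hB : ∀ x, β x ≤ B)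
    (hF : MemLp F 2 ν) (hH : MemLp H 2 ν) :
    ‖(∫ x, (β x : ℂ) * (conj (F x) * H x) ∂ν) * ((sqMass ν F + sqMass ν H : ℝ) : ℂ) -
        crossMass ν F H * ((∫ x, (β x : ℝ) * ‖F x‖ ^ 2 ∂ν + ∫ x, (β x : ℝ) * ‖H x‖ ^ 2 ∂ν : ℝ) : ℂ)‖
      ≤ B * (sqMass ν F + sqMass ν H) *
        √(sqMass ν F * sqMass ν H - ‖crossMass ν F H‖ ^ 2) := by
  have hmul : ∀ {G : α → ℂ}, MemLp G 2 ν → MemLp (fun x => (β x : ℂ) * G x) 2 ν := fun {G} hG =>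
    memLp_mul_of_bdd (B := B) (by simp) (by fun_prop) (fun x => by
      have : ‖((β x : ℝ) : ℂ)‖ₑ = β x := by
        rw [← ofReal_norm, Complex.norm_real]; simp
      rw [this]; exact_mod_cast hB x) hG
  have hF' := hmul hF
  have hH' := hmul hH
  have key := norm_inner_mul_sub_inner_mul_le (F := hF.toLp F) (H := hH.toLp H)
    (F' := hF'.toLp _) (H' := hH'.toLp _) (B := B) (norm_toLp_mul_le hB hF hF' fun x => rfl) (by
      set b : ℂ := ((‖hH.toLp H‖ ^ 2 : ℝ) : ℂ)
      set p : ℂ := inner ℂ (hH.toLp H) (hF.toLp F)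
      have k1 : MemLp (fun x => b * F x - p * H x) 2 ν := (hF.const_mul b).sub (hH.const_mul p)
      have k2 : MemLp (fun x => b * (β x * F x) - p * (β x * H x)) 2 ν :=
        (hF'.const_mul b).sub (hH'.const_mul p)
      have := norm_toLp_mul_le hB k1 k2 fun x => by ring
      have l1 : k1.toLp _ = b • hF.toLp F - p • hH.toLp H := by
        rw [← MemLp.toLp_const_smul, ← MemLp.toLp_const_smul, ← MemLp.toLp_sub]; rfl
      have l2 : k2.toLp _ = b • hF'.toLp _ - p • hH'.toLp _ := by
        rw [← MemLp.toLp_const_smul, ← MemLp.toLp_const_smul, ← MemLp.toLp_sub]; rfl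
      rwa [l1, l2] at this)
  rw [← sqMass_eq_norm_toLp, ← sqMass_eq_norm_toLp, ← crossMass_eq_inner, ← crossMass_eq_inner,
    ← crossMass_eq_inner, ← crossMass_eq_inner] at key
  have m1 : crossMass ν (fun x => (β x : ℂ) * F x) H = ∫ x, (β x : ℂ) * (conj (F x) * H x) ∂ν := by
    refine integral_congr_ae (.of_forall fun x => ?_)
    simp only [map_mul, Complex.conj_ofReal]
    ring
  have m2 : ∀ G : α → ℂ, crossMass ν (fun x => (β x : ℂ) * G x) G =
      ((∫ x, (β x : ℝ) * ‖G x‖ ^ 2 ∂ν : ℝ) : ℂ) := by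
    intro G
    rw [← integral_complex_ofReal]
    refine integral_congr_ae (.of_forall fun x => ?_)
    simp only [map_mul, Complex.conj_ofReal]
    rw [mul_assoc, mul_comm (conj (G x)), Complex.mul_conj, Complex.normSq_eq_norm_sq]
    push_cast; ring
  rw [m1, m2, m2, ← Complex.ofReal_add] at key
  exact key

theorem lintegral_enorm_kernel_sub [SFinite ν] (hF : MemLp F 2 ν) (hH : MemLp H 2 ν) :
    ∫⁻ p, ‖F p.1 * conj (F p.2) - H p.1 * conj (H p.2)‖ₑ ^ 2 ∂(ν.prod ν) =
      ENNReal.ofReal (gramDefect ν F H) := by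
  have i1 := (integrable_norm_sq hF).mul_prod (integrable_norm_sq hF)
  have i2 := (integrable_norm_sq hH).mul_prod (integrable_norm_sq hH)
  have i3 := (integrable_conj_mul hF hH).mul_prod (integrable_conj_mul hH hF)
  have hpt : ∀ p : α × α, ‖F p.1 * conj (F p.2) - H p.1 * conj (H p.2)‖ ^ 2 =
      ‖F p.1‖ ^ 2 * ‖F p.2‖ ^ 2 + ‖H p.1‖ ^ 2 * ‖H p.2‖ ^ 2 -
        2 * ((conj (F p.1) * H p.1) * (conj (H p.2) * F p.2)).re := by
    intro p
    rw [@norm_sub_sq ℂ, norm_mul, norm_mul, RCLike.norm_conj, RCLike.norm_conj,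
      RCLike.inner_apply, map_mul (starRingEnd ℂ), Complex.conj_conj, RCLike.re_to_complex]
    rw [show H p.1 * conj (H p.2) * (conj (F p.1) * F p.2) =
      (conj (F p.1) * H p.1) * (conj (H p.2) * F p.2) by ring]
    ring
  have i12 : Integrable (fun p : α × α => ‖F p.1‖ ^ 2 * ‖F p.2‖ ^ 2 + ‖H p.1‖ ^ 2 * ‖H p.2‖ ^ 2)
      (ν.prod ν) := i1.add i2
  have i3' : Integrable (fun p : α × α =>
      2 * ((conj (F p.1) * H p.1) * (conj (H p.2) * F p.2)).re) (ν.prod ν) := i3.re.const_mul 2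
  have i4 : Integrable (fun p : α × α => ‖F p.1 * conj (F p.2) - H p.1 * conj (H p.2)‖ ^ 2)
      (ν.prod ν) := by
    simp only [hpt]
    exact i12.sub i3'
  have e : ∀ p : α × α, ‖F p.1 * conj (F p.2) - H p.1 * conj (H p.2)‖ₑ ^ 2 =
      ENNReal.ofReal (‖F p.1 * conj (F p.2) - H p.1 * conj (H p.2)‖ ^ 2) := by
    intro p
    rw [ENNReal.ofReal_pow (norm_nonneg _), ofReal_norm]
  simp only [e]
  rw [← ofReal_integral_eq_lintegral_ofReal i4 (.of_forall fun p => by positivity)]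
  congr 1
  simp only [hpt]
  rw [integral_sub i12 i3', integral_add i1 i2, integral_const_mul,
    integral_prod_mul (fun x => ‖F x‖ ^ 2) (fun x => ‖F x‖ ^ 2),
    integral_prod_mul (fun x => ‖H x‖ ^ 2) (fun x => ‖H x‖ ^ 2)]
  have e2 : ∫ p : α × α, ((conj (F p.1) * H p.1) * (conj (H p.2) * F p.2)).re ∂(ν.prod ν) =
      ‖crossMass ν F H‖ ^ 2 := by
    have := integral_re i3
    simp only [RCLike.re_to_complex] at this
    rw [this, integral_prod_mul (fun x => conj (F x) * H x) (fun x => conj (H x) * F x)]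
    have hc : ∫ x, conj (H x) * F x ∂ν = conj (crossMass ν F H) := by
      rw [crossMass, ← integral_conj]
      refine integral_congr_ae (.of_forall fun x => ?_)
      simp [mul_comm]
    rw [hc]
    change (crossMass ν F H * conj (crossMass ν F H)).re = _
    rw [Complex.mul_conj, Complex.ofReal_re, Complex.normSq_eq_norm_sq]
  rw [e2]
  simp only [gramDefect, sqMass]
  ring

/-- The inner product of `F` and `H`, normalized by the mean of their squared norms. It is bounded
by one, also where it is not close to a phase factor. -/
noncomputable def localPhase (ν : Measure α) (F H : α → ℂ) : ℂ :=
  2 * crossMass ν F H / ((sqMass ν F + sqMass ν H : ℝ) : ℂ)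

theorem two_mul_norm_crossMass_le (hF : MemLp F 2 ν) (hH : MemLp H 2 ν) :
    2 * ‖crossMass ν F H‖ ≤ sqMass ν F + sqMass ν H := by
  have h := norm_crossMass_sq_le hF hH
  have ha := sqMass_nonneg ν F
  have hb := sqMass_nonneg ν H
  refine abs_le_of_sq_le_sq' ?_ (by positivity) |>.2
  nlinarith [sq_nonneg (sqMass ν F - sqMass ν H)]

theorem norm_localPhase_le_one (hF : MemLp F 2 ν) (hH : MemLp H 2 ν) :
    ‖localPhase ν F H‖ ≤ 1 := by
  have h := two_mul_norm_crossMass_le hF hH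
  have ha := sqMass_nonneg ν F
  have hb := sqMass_nonneg ν H
  rw [localPhase, norm_div, norm_mul, Complex.norm_real, Real.norm_of_nonneg (by positivity)]
  refine div_le_one_of_le₀ (by simpa using h) (by positivity)

theorem localPhase_mul (hF : MemLp F 2 ν) (hH : MemLp H 2 ν) :
    localPhase ν F H * ((sqMass ν F + sqMass ν H : ℝ) : ℂ) = 2 * crossMass ν F H := by
  have h := two_mul_norm_crossMass_le hF hH
  by_cases h0 : sqMass ν F + sqMass ν H = 0
  · have : ‖crossMass ν F H‖ = 0 := le_antisymm (by linarith) (norm_nonneg _)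
    rw [h0, norm_eq_zero.1 this]; simp
  · rw [localPhase, div_mul_cancel₀]
    exact_mod_cast h0

theorem gramDefect_nonneg (hF : MemLp F 2 ν) (hH : MemLp H 2 ν) : 0 ≤ gramDefect ν F H := by
  have h := norm_crossMass_sq_le hF hH
  rw [gramDefect]
  nlinarith [sq_nonneg (sqMass ν F - sqMass ν H)]

/-- The unit complex number in the direction of `c`, with the value `1` for `c = 0`. -/
noncomputable def phaseOf (c : ℂ) : Circle := Circle.exp (Complex.arg c)

theorem norm_sub_phaseOf (c : ℂ) : ‖c - phaseOf c‖ = |‖c‖ - 1| := by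
  have h : c = (‖c‖ : ℂ) * phaseOf c := by
    rw [phaseOf, Circle.coe_exp, Complex.norm_mul_exp_arg_mul_I]
  have h2 : c - phaseOf c = ((‖c‖ - 1 : ℝ) : ℂ) * phaseOf c := by
    rw [Complex.ofReal_sub, sub_mul, ← h]; simp
  rw [h2, norm_mul, Circle.norm_coe, mul_one, Complex.norm_real, Real.norm_eq_abs]

/-- The distance of `H` from `λ F`, for the phase `λ` of any complex number `c`, in terms of the
distance of the rank one kernels and of the distance of the local phase from `c`. -/
theorem sqMass_sub_phaseOf_sq_le (hF : MemLp F 2 ν) (hH : MemLp H 2 ν) (c : ℂ) :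
    sqMass ν (fun x => H x - phaseOf c * F x) ^ 2 ≤
      40 * gramDefect ν F H + 64 * (‖localPhase ν F H - c‖ ^ 2 * sqMass ν F ^ 2) := by
  have hP := norm_crossMass_sq_le hF hH
  have hN := two_mul_norm_crossMass_le hF hH
  have ha := sqMass_nonneg ν F
  have hb := sqMass_nonneg ν H
  have hv := norm_localPhase_le_one hF hH
  have hmul := localPhase_mul hF hH
  rw [sqMass_sub_smul hF hH]
  have hnorm : ‖localPhase ν F H‖ * (sqMass ν F + sqMass ν H) = 2 * ‖crossMass ν F H‖ := by
    have := congrArg norm hmul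
    rw [norm_mul, norm_mul, Complex.norm_real, Real.norm_of_nonneg (by positivity)] at this
    simpa using this
  have hre : 2 * (conj (phaseOf c : ℂ) * crossMass ν F H).re =
      (conj (phaseOf c : ℂ) * localPhase ν F H).re * (sqMass ν F + sqMass ν H) := by
    have := congrArg (fun w => (conj (phaseOf c : ℂ) * w).re) hmul
    simp only [← mul_assoc, Complex.re_mul_ofReal] at this
    rw [this, mul_comm (conj _) 2, mul_assoc]
    simp
  rw [hre]
  have hcc : conj (phaseOf c : ℂ) * (phaseOf c : ℂ) = 1 := by
    rw [mul_comm, Complex.mul_conj]; simp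
  -- `s = 1 - Re (conj λ v)` is the quantity to be estimated.
  have hs1 : 1 - (conj (phaseOf c : ℂ) * localPhase ν F H).re ≤
      (1 - ‖localPhase ν F H‖) + 2 * ‖localPhase ν F H - c‖ := by
    have e : 1 - (conj (phaseOf c : ℂ) * localPhase ν F H).re =
        (conj (phaseOf c : ℂ) * (phaseOf c - localPhase ν F H)).re := by
      rw [mul_sub, hcc]; simp
    have h1 : (conj (phaseOf c : ℂ) * (phaseOf c - localPhase ν F H)).re ≤
        ‖localPhase ν F H - phaseOf c‖ := by
      refine (Complex.re_le_norm _).trans ?_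
      rw [norm_mul, RCLike.norm_conj, Circle.norm_coe, one_mul, norm_sub_rev]
    have h2 : ‖localPhase ν F H - phaseOf c‖ ≤ ‖localPhase ν F H - c‖ + |‖c‖ - 1| := by
      rw [← norm_sub_phaseOf]
      exact norm_sub_le_norm_sub_add_norm_sub _ _ _
    have h3 : |‖c‖ - 1| ≤ |‖localPhase ν F H‖ - 1| + ‖localPhase ν F H - c‖ := by
      have := abs_norm_sub_norm_le c (localPhase ν F H)
      rw [norm_sub_rev] at this
      have t := abs_sub_le ‖c‖ ‖localPhase ν F H‖ 1
      linarith
    rw [abs_of_nonpos (a := ‖localPhase ν F H‖ - 1) (by linarith)] at h3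
    linarith
  have hs2 : |(conj (phaseOf c : ℂ) * localPhase ν F H).re| ≤ 1 := by
    refine (Complex.abs_re_le_norm _).trans ?_
    rw [norm_mul, RCLike.norm_conj, Circle.norm_coe, one_mul]
    exact hv
  obtain ⟨hs3, hs4⟩ := abs_le.1 hs2
  set s := (conj (phaseOf c : ℂ) * localPhase ν F H).re
  set a := sqMass ν F
  set b := sqMass ν H
  set p := ‖crossMass ν F H‖
  set v := ‖localPhase ν F H‖
  set d := ‖localPhase ν F H - c‖
  have hp : 0 ≤ p := norm_nonneg _
  have hv0 : 0 ≤ v := norm_nonneg _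
  have hd : 0 ≤ d := norm_nonneg _
  have hD : gramDefect ν F H = a ^ 2 + b ^ 2 - 2 * p ^ 2 := rfl
  rw [hD]
  have hab : (a - b) ^ 2 ≤ a ^ 2 + b ^ 2 - 2 * p ^ 2 := by nlinarith
  -- `N (1 - |v|) = a + b - 2 p`, whose square is at most twice the defect.
  have h1 : (a + b - 2 * p) ^ 2 ≤ 2 * (a ^ 2 + b ^ 2 - 2 * p ^ 2) := by
    nlinarith [sq_nonneg (a - b), mul_nonneg hp (sub_nonneg.2 hN)]
  have h2 : (a * (1 - v)) ^ 2 ≤ 2 * (a ^ 2 + b ^ 2 - 2 * p ^ 2) := by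
    refine le_trans (pow_le_pow_left₀ (by nlinarith) ?_ 2) h1
    nlinarith
  have h3 : (a + b - s * (a + b)) ^ 2 ≤ 8 * (a * (1 - s)) ^ 2 + 8 * (a - b) ^ 2 := by
    have e : a + b - s * (a + b) = 2 * (a * (1 - s)) + (b - a) * (1 - s) := by ring
    have : ((b - a) * (1 - s)) ^ 2 ≤ 4 * (a - b) ^ 2 := by
      have : (1 - s) ^ 2 ≤ 4 := by nlinarith
      nlinarith [mul_le_mul_of_nonneg_right this (sq_nonneg (b - a))]
    rw [e]
    nlinarith [sq_nonneg (2 * (a * (1 - s)) - (b - a) * (1 - s))]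
  have h4 : (a * (1 - s)) ^ 2 ≤ 2 * (a * (1 - v)) ^ 2 + 8 * (d ^ 2 * a ^ 2) := by
    have : (a * (1 - s)) ^ 2 ≤ (a * (1 - v) + 2 * (d * a)) ^ 2 := by
      refine pow_le_pow_left₀ (mul_nonneg ha (by linarith)) ?_ 2
      nlinarith
    nlinarith [sq_nonneg (a * (1 - v) - 2 * (d * a))]
  linarith

end GramMatrix

/-! ### Translation stable weights and local measures -/

section Weights
variable {d : ℕ} {γ μ : EuclideanSpace ℝ (Fin d) → ℝ≥0}

theorem IsLocallyBdd.exists_bound (h : IsLocallyBdd μ) {s : Set (EuclideanSpace ℝ (Fin d))}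
    (hs : IsCompact s) : ∃ B : ℝ≥0, ∀ y ∈ s, μ y ≤ B := by
  refine hs.induction_on (p := fun s => ∃ B : ℝ≥0, ∀ y ∈ s, μ y ≤ B) ⟨0, by simp⟩ ?_ ?_ ?_
  · rintro s t hst ⟨B, hB⟩
    exact ⟨B, fun y hy => hB y (hst hy)⟩
  · rintro s t ⟨B, hB⟩ ⟨B', hB'⟩
    exact ⟨max B B', fun y hy => hy.elim (fun h => (hB y h).trans (le_max_left _ _))
      fun h => (hB' y h).trans (le_max_right _ _)⟩
  · intro x _
    obtain ⟨U, hU, B, hB⟩ := h x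
    exact ⟨U, mem_nhdsWithin_of_mem_nhds hU, B, hB⟩

theorem IsTSW.pos (h : IsTSW γ) (h0 : γ ≠ 0) (z : EuclideanSpace ℝ (Fin d)) : 0 < γ z := by
  obtain ⟨μ, hμ⟩ := h
  obtain ⟨z0, hz0⟩ := Function.ne_iff.1 h0
  by_contra hz
  have hz : γ z = 0 := le_antisymm (not_lt.1 hz) (zero_le)
  have := hμ.le_mul z (z0 - z)
  rw [add_sub_cancel, hz, mul_zero] at this
  exact hz0 (le_antisymm this zero_le)

/-- A translation stable weight changes by at most a fixed factor on balls of radius one. -/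
theorem IsTSW.exists_le_mul (h : IsTSW γ) :
    ∃ B : ℝ≥0, 0 < B ∧ ∀ y z, dist y z ≤ 1 → γ y ≤ B * γ z := by
  obtain ⟨μ, hμ⟩ := h
  obtain ⟨B, hB⟩ := hμ.locallyBdd.exists_bound (isCompact_closedBall 0 1)
  refine ⟨B + 1, by positivity, fun y z hyz => ?_⟩
  have := hμ.le_mul z (y - z)
  rw [add_sub_cancel] at this
  refine this.trans ?_
  gcongr
  exact (hB _ (by simpa [dist_eq_norm] using hyz)).trans (by simp)

theorem selfCorrelation_apply (z : EuclideanSpace ℝ (Fin d)) :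
    selfCorrelation γ z = ∫⁻ y, (γ y : ℝ≥0∞) * γ (y - z) := by
  rw [selfCorrelation, lconvolution_def]
  refine lintegral_congr fun y => ?_
  congr 3
  abel

theorem selfCorrelation_neg (z : EuclideanSpace ℝ (Fin d)) :
    selfCorrelation γ (-z) = selfCorrelation γ z := by
  rw [selfCorrelation_apply, selfCorrelation_apply,
    ← lintegral_sub_right_eq_self (fun y => (γ y : ℝ≥0∞) * γ (y - -z)) z]
  refine lintegral_congr fun y => ?_
  rw [sub_neg_eq_add, sub_add_cancel, mul_comm]

theorem measurable_selfCorrelation (hγ : Continuous γ) : Measurable (selfCorrelation γ) := by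
  have := hγ.measurable
  exact measurable_lconvolution volume (by fun_prop) (by fun_prop)

theorem lintegral_selfCorrelation (hγ : Continuous γ) :
    ∫⁻ z, selfCorrelation γ z = (∫⁻ y, (γ y : ℝ≥0∞)) ^ 2 := by
  have hm := hγ.measurable
  simp only [selfCorrelation_apply]
  rw [lintegral_lintegral_swap (by fun_prop)]
  have : ∀ y, ∫⁻ z, (γ y : ℝ≥0∞) * γ (y - z) = γ y * ∫⁻ z, (γ z : ℝ≥0∞) := by
    intro y
    rw [lintegral_const_mul _ (by fun_prop), lintegral_sub_left_eq_self (fun z => (γ z : ℝ≥0∞)) y]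
  simp only [this]
  rw [lintegral_mul_const _ (by fun_prop), sq]

theorem selfCorrelation_ne_zero (hγ : Continuous γ) (hpos : ∀ z, 0 < γ z)
    (z : EuclideanSpace ℝ (Fin d)) : selfCorrelation γ z ≠ 0 := by
  have hm := hγ.measurable
  rw [selfCorrelation_apply, Ne, lintegral_eq_zero_iff (by fun_prop)]
  intro h
  have h2 : ∀ᵐ y : EuclideanSpace ℝ (Fin d), False := by
    filter_upwards [h] with y hy
    have : (γ y : ℝ≥0∞) * γ (y - z) ≠ 0 :=
      mul_ne_zero (by exact_mod_cast (hpos _).ne') (by exact_mod_cast (hpos _).ne')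
    exact this hy
  exact h2.exists.choose_spec

theorem lintegral_selfCorrelation_mul_sq_lt_top (hγ : Continuous γ)
    (hμ : MemLp (fun z => (μ z : ℝ)) 2 (volume.withDensity (selfCorrelation γ))) :
    ∫⁻ z, selfCorrelation γ z * (μ z : ℝ≥0∞) ^ 2 < ⊤ := by
  have h := (eLpNorm_lt_top_iff_lintegral_rpow_enorm_lt_top (by norm_num) (by norm_num)).1 hμ.2
  rw [lintegral_withDensity_eq_lintegral_mul₀' (measurable_selfCorrelation hγ).aemeasurable
    (hμ.1.enorm.pow_const _)] at h
  refine lt_of_eq_of_lt (lintegral_congr fun z => ?_) h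
  simp

/-- A weight with a controlling function of another weight in `L²(γ ∗ Rγ)` is integrable, since a
controlling function `μ` of a nontrivial weight satisfies `μ(τ) μ(-τ) ≥ 1`. -/
theorem lintegral_weight_lt_top (hγ : Continuous γ) (hpos : ∀ z, 0 < γ z)
    (hμ : MemLp (fun z => (μ z : ℝ)) 2 (volume.withDensity (selfCorrelation γ)))
    (h1 : ∀ z, 1 ≤ μ z * μ (-z)) : ∫⁻ z, (γ z : ℝ≥0∞) < ⊤ := by
  have hM := lintegral_selfCorrelation_mul_sq_lt_top hγ hμ
  have hmeas : AEMeasurable (fun z => selfCorrelation γ z * (μ z : ℝ≥0∞) ^ 2) := by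
    have hac := withDensity_absolutelyContinuous' (μ := volume)
      (measurable_selfCorrelation hγ).aemeasurable
      (.of_forall fun z => selfCorrelation_ne_zero hγ hpos z)
    have h2 : AEMeasurable (fun z => (μ z : ℝ)) := (hμ.1.mono_ac hac).aemeasurable
    have h3 : AEMeasurable (fun z => (μ z : ℝ≥0∞)) := by
      simpa using h2.ennreal_ofReal
    exact (measurable_selfCorrelation hγ).aemeasurable.mul (h3.pow_const 2)
  have hlt : ∫⁻ z, selfCorrelation γ z < ⊤ := by
    have hle : ∀ z, selfCorrelation γ z ≤ selfCorrelation γ z * (μ z : ℝ≥0∞) ^ 2 +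
        selfCorrelation γ (-z) * (μ (-z) : ℝ≥0∞) ^ 2 := by
      intro z
      rw [selfCorrelation_neg, ← mul_add]
      refine le_mul_of_one_le_right' ?_
      have : (1 : ℝ≥0) ≤ μ z ^ 2 + μ (-z) ^ 2 := by
        have h := h1 z
        have h' : (1 : ℝ) ≤ μ z * μ (-z) := by exact_mod_cast h
        have : (1 : ℝ) ≤ (μ z : ℝ) ^ 2 + (μ (-z) : ℝ) ^ 2 := by
          nlinarith [sq_nonneg ((μ z : ℝ) - μ (-z))]
        exact_mod_cast this
      exact_mod_cast this
    refine lt_of_le_of_lt (lintegral_mono hle) ?_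
    rw [lintegral_add_left' hmeas,
      lintegral_neg_eq_self (fun z => selfCorrelation γ z * (μ z : ℝ≥0∞) ^ 2)]
    exact ENNReal.add_lt_top.2 ⟨hM, hM⟩
  rw [lintegral_selfCorrelation hγ] at hlt
  by_contra h
  rw [not_lt_top_iff.1 h] at hlt
  simp at hlt

/-- The measure with density `x ↦ γ(z - x)`. -/
noncomputable def localMeasure (γ : EuclideanSpace ℝ (Fin d) → ℝ≥0)
    (z : EuclideanSpace ℝ (Fin d)) : Measure (EuclideanSpace ℝ (Fin d)) :=
  volume.withDensity fun x => (γ (z - x) : ℝ≥0∞)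

theorem lintegral_localMeasure (hγ : Continuous γ) (z : EuclideanSpace ℝ (Fin d))
    {G : EuclideanSpace ℝ (Fin d) → ℝ≥0∞} (hG : Measurable G) :
    ∫⁻ x, G x ∂(localMeasure γ z) = ∫⁻ x, γ (z - x) * G x := by
  have := hγ.measurable
  exact lintegral_withDensity_eq_lintegral_mul _ (by fun_prop) hG

theorem integral_localMeasure {V : Type*} [NormedAddCommGroup V] [NormedSpace ℝ V]
    (hγ : Continuous γ) (z : EuclideanSpace ℝ (Fin d)) (G : EuclideanSpace ℝ (Fin d) → V) :
    ∫ x, G x ∂(localMeasure γ z) = ∫ x, (γ (z - x)) • G x := by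
  have := hγ.measurable
  exact integral_withDensity_eq_integral_smul (f := fun x => γ (z - x)) (by fun_prop) G

theorem isFiniteMeasure_localMeasure (hint : ∫⁻ z, (γ z : ℝ≥0∞) < ⊤)
    (z : EuclideanSpace ℝ (Fin d)) : IsFiniteMeasure (localMeasure γ z) := by
  refine isFiniteMeasure_withDensity ?_
  rw [lintegral_sub_left_eq_self (fun x => (γ x : ℝ≥0∞)) z]
  exact hint.ne

theorem memLp_localMeasure (hint : ∫⁻ z, (γ z : ℝ≥0∞) < ⊤)
    (z : EuclideanSpace ℝ (Fin d)) {F : EuclideanSpace ℝ (Fin d) → ℂ} (hF : Measurable F)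
    {B : ℝ} (hB : ∀ x, ‖F x‖ ≤ B) : MemLp F 2 (localMeasure γ z) := by
  have := isFiniteMeasure_localMeasure hint z
  exact MemLp.of_bound hF.aestronglyMeasurable B (.of_forall hB)

theorem measurable_integral_localMeasure {V : Type*} [NormedAddCommGroup V] [NormedSpace ℝ V]
    [MeasurableSpace V] [BorelSpace V] [SecondCountableTopology V]
    (hγ : Continuous γ) {G : EuclideanSpace ℝ (Fin d) → V} (hG : Measurable G) :
    Measurable fun z => ∫ x, G x ∂(localMeasure γ z) := by
  have := hγ.measurable
  simp only [integral_localMeasure hγ]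
  have h : StronglyMeasurable (Function.uncurry fun z x : EuclideanSpace ℝ (Fin d) =>
      (γ (z - x)) • G x) := by
    refine Measurable.stronglyMeasurable ?_
    simp only [Function.uncurry_def, NNReal.smul_def]
    fun_prop
  exact h.integral_prod_right.measurable

variable {F H : EuclideanSpace ℝ (Fin d) → ℂ}

/-- Averaging the local measures of pairs gives the weight `γ ∗ Rγ` in the difference variable. -/
theorem lintegral_kernel_eq (hγ : Continuous γ)
    {Q : EuclideanSpace ℝ (Fin d) × EuclideanSpace ℝ (Fin d) → ℝ≥0∞} (hQ : Measurable Q) :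
    ∫⁻ z, ∫⁻ p, Q p ∂((localMeasure γ z).prod (localMeasure γ z)) =
      ∫⁻ τ, selfCorrelation γ τ * ∫⁻ x, Q (x, x - τ) := by
  have hm := hγ.measurable
  have hsf : ∀ z, SFinite (localMeasure γ z) := fun z => by unfold localMeasure; infer_instance
  have e1 : ∀ z, ∫⁻ p, Q p ∂((localMeasure γ z).prod (localMeasure γ z)) =
      ∫⁻ x, ∫⁻ τ, γ (z - x) * (γ (z - x + τ) * Q (x, x - τ)) := by
    intro z
    rw [lintegral_prod _ hQ.aemeasurable]
    have h1 : ∀ x, ∫⁻ y, Q (x, y) ∂(localMeasure γ z) =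
        ∫⁻ τ, (γ (z - x + τ) * Q (x, x - τ)) := by
      intro x
      rw [lintegral_localMeasure hγ z (by fun_prop),
        ← lintegral_sub_left_eq_self (fun y => γ (z - y) * Q (x, y)) x]
      refine lintegral_congr fun τ => ?_
      congr 3
      abel
    simp only [h1]
    have h2 : Measurable fun p : EuclideanSpace ℝ (Fin d) × EuclideanSpace ℝ (Fin d) =>
        (γ (z - p.1 + p.2) : ℝ≥0∞) * Q (p.1, p.1 - p.2) := by fun_prop
    rw [lintegral_localMeasure hγ z h2.lintegral_prod_right']
    refine lintegral_congr fun x => ?_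
    rw [lintegral_const_mul _ (by fun_prop)]
  simp only [e1]
  have hm3 : Measurable fun q : (EuclideanSpace ℝ (Fin d) × EuclideanSpace ℝ (Fin d)) ×
      EuclideanSpace ℝ (Fin d) =>
      (γ (q.1.1 - q.1.2) : ℝ≥0∞) * (γ (q.1.1 - q.1.2 + q.2) * Q (q.1.2, q.1.2 - q.2)) := by
    fun_prop
  rw [lintegral_lintegral_swap hm3.lintegral_prod_right'.aemeasurable]
  have e2 : ∀ x, ∫⁻ z, ∫⁻ τ, (γ (z - x) : ℝ≥0∞) * (γ (z - x + τ) * Q (x, x - τ)) =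
      ∫⁻ τ, selfCorrelation γ τ * Q (x, x - τ) := by
    intro x
    rw [lintegral_lintegral_swap (by fun_prop)]
    refine lintegral_congr fun τ => ?_
    simp only [← mul_assoc]
    rw [lintegral_mul_const _ (by fun_prop), selfCorrelation_apply]
    congr 1
    rw [← lintegral_sub_right_eq_self (fun y => (γ y : ℝ≥0∞) * γ (y - τ)) (x - τ)]
    refine lintegral_congr fun z => ?_
    rw [mul_comm]
    congr 3 <;> abel
  simp only [e2]
  have hsm := measurable_selfCorrelation hγ
  rw [lintegral_lintegral_swap (by fun_prop)]
  refine lintegral_congr fun τ => ?_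
  rw [lintegral_const_mul _ (by fun_prop)]

/-- Integrated over the plane, the local defects are controlled by correlations. -/
theorem lintegral_gramDefect_le (hγ : Continuous γ) (hint : ∫⁻ z, (γ z : ℝ≥0∞) < ⊤)
    (hF : Measurable F) (hH : Measurable H) {B B' : ℝ} (hB : ∀ x, ‖F x‖ ≤ B)
    (hB' : ∀ x, ‖H x‖ ≤ B') {Q : ℝ≥0∞} (hQ : Q ≠ ⊤)
    (hcor : ∀ τ, ∫⁻ x, ‖F x * conj (F (x - τ)) - H x * conj (H (x - τ))‖ₑ ^ 2 ≤ μ τ ^ 2 * Q) :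
    ∫⁻ z, ENNReal.ofReal (gramDefect (localMeasure γ z) F H) ≤
      (∫⁻ z, selfCorrelation γ z * (μ z : ℝ≥0∞) ^ 2) * Q := by
  have e : ∀ z, ENNReal.ofReal (gramDefect (localMeasure γ z) F H) =
      ∫⁻ p, ‖F p.1 * conj (F p.2) - H p.1 * conj (H p.2)‖ₑ ^ 2
        ∂((localMeasure γ z).prod (localMeasure γ z)) := by
    intro z
    have := isFiniteMeasure_localMeasure hint z
    exact (lintegral_enorm_kernel_sub (memLp_localMeasure hint z hF hB)
      (memLp_localMeasure hint z hH hB')).symm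
  simp only [e]
  rw [lintegral_kernel_eq hγ (Q := fun p => ‖F p.1 * conj (F p.2) - H p.1 * conj (H p.2)‖ₑ ^ 2)
    (by fun_prop), ← lintegral_mul_const' _ _ hQ]
  refine lintegral_mono fun τ => ?_
  rw [mul_assoc]
  gcongr
  exact hcor τ

end Weights

/-! ### Mollification of bounded functions -/

section Mollification
open scoped Convolution

variable {d : ℕ}

theorem norm_convolution_le_of_closedBall {V W : Type*} [NormedAddCommGroup V] [NormedSpace ℝ V]
    [NormedAddCommGroup W] [NormedSpace ℝ W] (L : ℂ →L[ℝ] V →L[ℝ] W)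
    {ρ : EuclideanSpace ℝ (Fin d) → V} (hρ : Continuous ρ) (hρc : HasCompactSupport ρ)
    (hsupp : tsupport ρ ⊆ Metric.closedBall 0 1) {v : EuclideanSpace ℝ (Fin d) → ℂ}
    {z : EuclideanSpace ℝ (Fin d)} {δ : ℝ} (hv : ∀ t, dist t z ≤ 1 → ‖v t‖ ≤ δ) :
    ‖(v ⋆[L, volume] ρ) z‖ ≤ ‖L‖ * δ * ∫ t, ‖ρ t‖ := by
  have hi : Integrable fun t => ‖ρ t‖ := (hρ.integrable_of_hasCompactSupport hρc).norm
  rw [convolution_def, ← integral_sub_left_eq_self (fun t => ‖ρ t‖) volume z, ← integral_const_mul]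
  refine norm_integral_le_of_norm_le ((hi.comp_sub_left z).const_mul _) (.of_forall fun t => ?_)
  by_cases h : ρ (z - t) = 0
  · simp [h]
  · have ht : dist t z ≤ 1 := by
      have := hsupp (subset_tsupport ρ h)
      rwa [mem_closedBall_zero_iff, ← dist_eq_norm, dist_comm] at this
    refine (L.le_opNorm₂ _ _).trans ?_
    have := hv t ht
    gcongr

theorem exists_norm_convolution_le {V W : Type*} [NormedAddCommGroup V] [NormedSpace ℝ V]
    [NormedAddCommGroup W] [NormedSpace ℝ W] (L : ℂ →L[ℝ] V →L[ℝ] W)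
    {ρ : EuclideanSpace ℝ (Fin d) → V} (hρ : Continuous ρ) (hρc : HasCompactSupport ρ)
    (hsupp : tsupport ρ ⊆ Metric.closedBall 0 1) :
    ∃ K : ℝ≥0, ∀ (v : EuclideanSpace ℝ (Fin d) → ℂ) (z : EuclideanSpace ℝ (Fin d)) (δ : ℝ),
      (∀ t, dist t z ≤ 1 → ‖v t‖ ≤ δ) → ‖(v ⋆[L, volume] ρ) z‖ ≤ K * δ := by
  refine ⟨(‖L‖ * ∫ t, ‖ρ t‖).toNNReal, fun v z δ hv => ?_⟩
  rw [Real.coe_toNNReal _ (by positivity)]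
  exact (norm_convolution_le_of_closedBall L hρ hρc hsupp hv).trans (le_of_eq (by ring))

theorem exists_bound_iteratedFDeriv_convolution {v : EuclideanSpace ℝ (Fin d) → ℂ}
    (hv : LocallyIntegrable v) {b : ℝ} (hb : ∀ t, ‖v t‖ ≤ b) (k : ℕ) :
    ∀ {V W : Type} [NormedAddCommGroup V] [NormedSpace ℝ V] [NormedAddCommGroup W]
      [NormedSpace ℝ W] (L : ℂ →L[ℝ] V →L[ℝ] W) {ρ : EuclideanSpace ℝ (Fin d) → V},
      ContDiff ℝ ∞ ρ → HasCompactSupport ρ → tsupport ρ ⊆ Metric.closedBall 0 1 →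
      ∃ B : ℝ, ∀ z, ‖iteratedFDeriv ℝ k (v ⋆[L, volume] ρ) z‖ ≤ B := by
  induction k with
  | zero =>
    intro V W _ _ _ _ L ρ hρ hρc hsupp
    refine ⟨‖L‖ * b * ∫ t, ‖ρ t‖, fun z => ?_⟩
    rw [norm_iteratedFDeriv_zero]
    exact norm_convolution_le_of_closedBall L hρ.continuous hρc hsupp fun t _ => hb t
  | succ k ih =>
    intro V W _ _ _ _ L ρ hρ hρc hsupp
    obtain ⟨B, hB⟩ := ih (L.precompR (EuclideanSpace ℝ (Fin d)))
      (hρ.fderiv_right (m := ∞) (by simp)) (hρc.fderiv ℝ) ((tsupport_fderiv_subset ℝ).trans hsupp)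
    refine ⟨B, fun z => ?_⟩
    have e : fderiv ℝ (v ⋆[L, volume] ρ) =
        (v ⋆[L.precompR (EuclideanSpace ℝ (Fin d)), volume] fderiv ℝ ρ) :=
      funext fun z => (hρc.hasFDerivAt_convolution_right L hv (hρ.of_le (by simp)) z).fderiv
    rw [← norm_iteratedFDeriv_fderiv, e]
    exact hB z

/-- Bounded measurable functions can be mollified into `C_b^∞`, with the error and the gradient
controlled by the oscillation on balls of radius one. -/
theorem exists_mollification (d : ℕ) : ∃ K : ℝ≥0, ∀ v : EuclideanSpace ℝ (Fin d) → ℂ,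
    Measurable v → (∀ z, ‖v z‖ ≤ 1) → ∃ u : EuclideanSpace ℝ (Fin d) → ℂ, IsCbSmooth u ∧
      ∀ (z : EuclideanSpace ℝ (Fin d)) (δ : ℝ), (∀ t, dist t z ≤ 1 → ‖v t - v z‖ ≤ δ) →
        ‖u z - v z‖ ≤ δ ∧ ‖fderiv ℝ u z‖ ≤ K * δ := by
  let φ : ContDiffBump (0 : EuclideanSpace ℝ (Fin d)) := ⟨1 / 2, 1, by norm_num, by norm_num⟩
  let ρ : EuclideanSpace ℝ (Fin d) → ℝ := φ.normed volume
  have hρ : ContDiff ℝ ∞ ρ := φ.contDiff_normed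
  have hρc : HasCompactSupport ρ := φ.hasCompactSupport_normed
  have hsupp : tsupport ρ ⊆ Metric.closedBall 0 1 := (φ.tsupport_normed_eq (μ := volume)).subset
  let L : ℂ →L[ℝ] ℝ →L[ℝ] ℂ := (ContinuousLinearMap.lsmul ℝ ℝ).flip
  have hL : ‖L‖ ≤ 1 := by
    rw [ContinuousLinearMap.opNorm_flip]
    exact ContinuousLinearMap.opNorm_lsmul_le
  have hρint : ∫ t, ‖ρ t‖ = 1 := by
    rw [← φ.integral_normed (μ := volume)]
    refine integral_congr_ae (.of_forall fun t => ?_)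
    exact Real.norm_of_nonneg (φ.nonneg_normed t)
  have hloc : ∀ w : EuclideanSpace ℝ (Fin d) → ℂ, Measurable w → ∀ b : ℝ, (∀ z, ‖w z‖ ≤ b) →
      LocallyIntegrable w := fun w hw b hb =>
    (memLp_top_of_bound hw.aestronglyMeasurable b (.of_forall hb)).locallyIntegrable le_top
  obtain ⟨K, hK⟩ := exists_norm_convolution_le (L.precompR (EuclideanSpace ℝ (Fin d)))
    (hρ.continuous_fderiv (by simp)) (hρc.fderiv ℝ) ((tsupport_fderiv_subset ℝ).trans hsupp)
  refine ⟨K, fun v hvm hv => ⟨v ⋆[L, volume] ρ, ⟨?_, ?_⟩, ?_⟩⟩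
  · exact hρc.contDiff_convolution_right (n := ⊤) L (hloc v hvm 1 hv) hρ
  · exact fun k => exists_bound_iteratedFDeriv_convolution (hloc v hvm 1 hv) hv k L hρ hρc hsupp
  intro z δ hδ
  let w : EuclideanSpace ℝ (Fin d) → ℂ := fun t => v t - v z
  have hwm : Measurable w := hvm.sub_const _
  have hwb : ∀ t, ‖w t‖ ≤ 2 := fun t => (norm_sub_le _ _).trans (by linarith [hv t, hv z])
  -- As `ρ` has mass one, subtracting a constant from `v` subtracts it from the mollification.
  have hsub : (w ⋆[L, volume] ρ) = fun y => (v ⋆[L, volume] ρ) y - v z := by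
    funext y
    have hc : ∫ t, L (v z) (ρ (y - t)) = v z := by
      rw [integral_sub_left_eq_self (fun t => L (v z) (ρ t)) volume y]
      simp only [L, ContinuousLinearMap.flip_apply, ContinuousLinearMap.lsmul_apply]
      rw [integral_smul_const, φ.integral_normed, one_smul]
    refine Eq.trans (b := (v ⋆[L, volume] ρ) y - ∫ t, L (v z) (ρ (y - t))) ?_ (by rw [hc])
    rw [convolution_def, convolution_def, ← integral_sub]
    · simp [w]
    · exact hρc.convolutionExists_right L (hloc v hvm 1 hv) hρ.continuous y
    · exact hρc.convolutionExists_right L (continuous_const (y := v z)).locallyIntegrable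
        hρ.continuous y
  have hδ0 : 0 ≤ δ := (norm_nonneg _).trans (hδ z (by simp))
  refine ⟨?_, ?_⟩
  · have h1 := norm_convolution_le_of_closedBall L hρ.continuous hρc hsupp (v := w) hδ
    rw [hsub, hρint, mul_one] at h1
    exact h1.trans (by nlinarith)
  · have e : fderiv ℝ (v ⋆[L, volume] ρ) z =
        (w ⋆[L.precompR (EuclideanSpace ℝ (Fin d)), volume] fderiv ℝ ρ) z := by
      rw [← (hρc.hasFDerivAt_convolution_right L (hloc w hwm 2 hwb) (hρ.of_le (by simp)) z).fderiv,
        hsub, fderiv_sub_const]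
    rw [e]
    exact hK w z δ hδ

end Mollification

/-! ### From local to global phases -/

section LocalEstimates
variable {d : ℕ} {γ : EuclideanSpace ℝ (Fin d) → ℝ≥0} {F H : EuclideanSpace ℝ (Fin d) → ℂ}

theorem measurable_sqMass (hγ : Continuous γ) (hF : Measurable F) :
    Measurable fun z => sqMass (localMeasure γ z) F :=
  measurable_integral_localMeasure hγ (by fun_prop)

theorem measurable_crossMass (hγ : Continuous γ) (hF : Measurable F) (hH : Measurable H) :
    Measurable fun z => crossMass (localMeasure γ z) F H :=
  measurable_integral_localMeasure hγ (by fun_prop)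

theorem measurable_gramDefect (hγ : Continuous γ) (hF : Measurable F) (hH : Measurable H) :
    Measurable fun z => gramDefect (localMeasure γ z) F H := by
  have := measurable_sqMass hγ hF
  have := measurable_sqMass hγ hH
  have := measurable_crossMass hγ hF hH
  unfold gramDefect
  fun_prop

theorem measurable_localPhase (hγ : Continuous γ) (hF : Measurable F) (hH : Measurable H) :
    Measurable fun z => localPhase (localMeasure γ z) F H := by
  have := measurable_sqMass hγ hF
  have := measurable_sqMass hγ hH
  have := measurable_crossMass hγ hF hH
  unfold localPhase
  fun_prop

theorem ofReal_sqMass {α : Type*} [MeasurableSpace α] {ν : Measure α} {G : α → ℂ}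
    (hG : MemLp G 2 ν) : ENNReal.ofReal (sqMass ν G) = ∫⁻ x, ‖G x‖ₑ ^ 2 ∂ν := by
  rw [sqMass, ofReal_integral_eq_lintegral_ofReal (integrable_norm_sq hG)
    (.of_forall fun x => by positivity)]
  refine lintegral_congr fun x => ?_
  rw [ENNReal.ofReal_pow (norm_nonneg _), ofReal_norm]

theorem smoothedWeight_eq (hγ : Continuous γ) (hint : ∫⁻ z, (γ z : ℝ≥0∞) < ⊤)
    (hF : Measurable F) {b : ℝ} (hb : ∀ x, ‖F x‖ ≤ b) (z : EuclideanSpace ℝ (Fin d)) :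
    smoothedWeight F γ z = ENNReal.ofReal (sqMass (localMeasure γ z) F) ^ 2 := by
  rw [ofReal_sqMass (memLp_localMeasure hint z hF hb), lintegral_localMeasure hγ z (by fun_prop),
    smoothedWeight, lconvolution_def]
  congr 1
  refine lintegral_congr fun x => ?_
  rw [mul_comm, neg_add_eq_sub]

theorem integral_localMeasure_change {V : Type*} [NormedAddCommGroup V] [NormedSpace ℝ V]
    (hγ : Continuous γ) (hpos : ∀ z, 0 < γ z) (y z : EuclideanSpace ℝ (Fin d))
    (G : EuclideanSpace ℝ (Fin d) → V) :
    ∫ x, G x ∂(localMeasure γ y) =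
      ∫ x, ((γ (y - x) / γ (z - x) : ℝ≥0) : ℝ) • G x ∂(localMeasure γ z) := by
  rw [integral_localMeasure hγ, integral_localMeasure hγ]
  refine integral_congr_ae (.of_forall fun x => ?_)
  simp only [NNReal.smul_def]
  rw [smul_smul, ← NNReal.coe_mul, mul_div_cancel₀ _ (hpos _).ne']

theorem sqMass_localMeasure_le (hγ : Continuous γ) (hint : ∫⁻ z, (γ z : ℝ≥0∞) < ⊤)
    {B : ℝ≥0} (hB : ∀ y z, dist y z ≤ 1 → γ y ≤ B * γ z)
    (hF : Measurable F) {b : ℝ} (hb : ∀ x, ‖F x‖ ≤ b) {y z : EuclideanSpace ℝ (Fin d)}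
    (hyz : dist y z ≤ 1) :
    sqMass (localMeasure γ y) F ≤ B * sqMass (localMeasure γ z) F := by
  have h : ENNReal.ofReal (sqMass (localMeasure γ y) F) ≤
      ENNReal.ofReal (B * sqMass (localMeasure γ z) F) := by
    have hm := hγ.measurable
    rw [ENNReal.ofReal_mul (by positivity), ofReal_sqMass (memLp_localMeasure hint y hF hb),
      ofReal_sqMass (memLp_localMeasure hint z hF hb), lintegral_localMeasure hγ y (by fun_prop),
      lintegral_localMeasure hγ z (by fun_prop), ENNReal.ofReal_coe_nnreal,
      ← lintegral_const_mul _ (by fun_prop)]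
    refine lintegral_mono fun x => ?_
    rw [← mul_assoc]
    gcongr
    exact (ENNReal.coe_le_coe.2 (hB (y - x) (z - x) (by simpa using hyz))).trans_eq
      (ENNReal.coe_mul _ _)
  exact (ENNReal.ofReal_le_ofReal_iff (mul_nonneg B.2 (sqMass_nonneg _ _))).1 h

/-- The oscillation of the local phase on unit balls is controlled by the local defect. -/
theorem norm_localPhase_sub_mul_le (hγ : Continuous γ) (hpos : ∀ z, 0 < γ z)
    (hint : ∫⁻ z, (γ z : ℝ≥0∞) < ⊤) {B : ℝ≥0} (hB : ∀ y z, dist y z ≤ 1 → γ y ≤ B * γ z)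
    (hF : Measurable F) (hH : Measurable H) {b b' : ℝ} (hb : ∀ x, ‖F x‖ ≤ b)
    (hb' : ∀ x, ‖H x‖ ≤ b') {y z : EuclideanSpace ℝ (Fin d)} (hyz : dist y z ≤ 1) :
    ‖localPhase (localMeasure γ y) F H - localPhase (localMeasure γ z) F H‖ *
        (sqMass (localMeasure γ z) F + sqMass (localMeasure γ z) H) ≤
      2 * B ^ 2 * √(gramDefect (localMeasure γ z) F H) := by
  have hmF := memLp_localMeasure hint z hF hb
  have hmH := memLp_localMeasure hint z hH hb'
  have hγm := hγ.measurable
  have key := norm_crossMass_mul_sub_le (ν := localMeasure γ z)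
    (β := fun x => γ (y - x) / γ (z - x)) (B := B) (by fun_prop) (fun x => by
      rw [div_le_iff₀ (hpos _)]
      exact hB _ _ (by simpa using hyz)) hmF hmH
  have c1 := integral_localMeasure_change hγ hpos y z (fun x => conj (F x) * H x)
  have c2 := integral_localMeasure_change hγ hpos y z (fun x => ‖F x‖ ^ 2)
  have c3 := integral_localMeasure_change hγ hpos y z (fun x => ‖H x‖ ^ 2)
  simp only [Complex.real_smul, smul_eq_mul] at c1 c2 c3
  rw [← c1, ← c2, ← c3] at key
  have nF := sqMass_localMeasure_le hγ hint hB hF hb ((dist_comm z y).trans_le hyz)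
  have nH := sqMass_localMeasure_le hγ hint hB hH hb' ((dist_comm z y).trans_le hyz)
  change ‖crossMass (localMeasure γ y) F H * _ - _ *
    ((sqMass (localMeasure γ y) F + sqMass (localMeasure γ y) H : ℝ) : ℂ)‖ ≤ _ at key
  have hG : √(sqMass (localMeasure γ z) F * sqMass (localMeasure γ z) H -
      ‖crossMass (localMeasure γ z) F H‖ ^ 2) ≤ √(gramDefect (localMeasure γ z) F H) := by
    refine Real.sqrt_le_sqrt ?_
    have := norm_crossMass_sq_le hmF hmH
    rw [gramDefect]
    nlinarith [sq_nonneg (sqMass (localMeasure γ z) F - sqMass (localMeasure γ z) H)]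
  have hR := Real.sqrt_nonneg (gramDefect (localMeasure γ z) F H)
  set R := √(gramDefect (localMeasure γ z) F H)
  have hN0 : 0 ≤ sqMass (localMeasure γ z) F + sqMass (localMeasure γ z) H :=
    add_nonneg (sqMass_nonneg _ _) (sqMass_nonneg _ _)
  have hNN : sqMass (localMeasure γ z) F + sqMass (localMeasure γ z) H ≤
    B * (sqMass (localMeasure γ y) F + sqMass (localMeasure γ y) H) := by linarith
  rcases hN0.eq_or_lt with h0 | h0
  · rw [← h0, mul_zero]
    positivity
  unfold localPhase
  set N := sqMass (localMeasure γ z) F + sqMass (localMeasure γ z) H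
  set N' := sqMass (localMeasure γ y) F + sqMass (localMeasure γ y) H
  set P := crossMass (localMeasure γ z) F H
  set P' := crossMass (localMeasure γ y) F H
  have hN' : 0 < N' := by
    by_contra h
    have := mul_nonpos_of_nonneg_of_nonpos B.2 (not_lt.1 h)
    change (B : ℝ) * N' ≤ 0 at this
    linarith
  have e : 2 * P' / (N' : ℂ) - 2 * P / (N : ℂ) = 2 * (P' * N - P * N') / (N' * N) := by
    have h1 : (N : ℂ) ≠ 0 := by exact_mod_cast h0.ne'
    have h2 : (N' : ℂ) ≠ 0 := by exact_mod_cast hN'.ne'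
    field_simp
  rw [e, norm_div, norm_mul, norm_mul, Complex.norm_real, Complex.norm_real,
    Real.norm_of_nonneg h0.le, Real.norm_of_nonneg hN'.le, Complex.norm_ofNat, div_mul_eq_mul_div,
    div_le_iff₀ (by positivity)]
  calc 2 * ‖P' * N - P * N'‖ * N ≤ 2 * (B * N * R) * N := by
        have := key.trans (mul_le_mul_of_nonneg_left hG (by positivity))
        gcongr
    _ = (2 * B * R * N) * N := by ring
    _ ≤ (2 * B * R * N) * (B * N') := by gcongr
    _ = 2 * B ^ 2 * R * (N' * N) := by ring

/-- On unit balls, Lebesgue measure is dominated by the local measures. -/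
theorem eLpNorm_ball_pow_four_le (hγ : Continuous γ) (hpos : ∀ z, 0 < γ z)
    (hint : ∫⁻ z, (γ z : ℝ≥0∞) < ⊤) {B : ℝ≥0} (hB : ∀ y z, dist y z ≤ 1 → γ y ≤ B * γ z)
    (hF : Measurable F) {b : ℝ} (hb : ∀ x, ‖F x‖ ≤ b) (z : EuclideanSpace ℝ (Fin d)) :
    eLpNorm F 2 (volume.restrict (Metric.ball z 1)) ^ 4 ≤
      ((B / γ 0) ^ 2 : ℝ≥0) * ENNReal.ofReal (sqMass (localMeasure γ z) F ^ 2) := by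
  have hm := hγ.measurable
  rw [show (4 : ℕ) = 2 * 2 by norm_num, pow_mul, eLpNorm_two_sq, ENNReal.coe_pow,
    ENNReal.ofReal_pow (sqMass_nonneg _ _), ← mul_pow]
  gcongr
  rw [ofReal_sqMass (memLp_localMeasure hint z hF hb), lintegral_localMeasure hγ z (by fun_prop),
    ← lintegral_const_mul _ (by fun_prop)]
  refine le_trans (setLIntegral_mono (g := fun x => (B / γ 0 : ℝ≥0) * (γ (z - x) * ‖F x‖ₑ ^ 2))
    (by fun_prop) fun x hx => ?_) (setLIntegral_le_lintegral _ _)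
  rw [← mul_assoc]
  refine le_mul_of_one_le_left' ?_
  have h := hB 0 (z - x) (by
    rw [dist_comm, dist_zero_right, ← dist_eq_norm, dist_comm]
    exact (Metric.mem_ball.1 hx).le)
  have : (1 : ℝ≥0) ≤ B / γ 0 * γ (z - x) := by
    rw [div_mul_eq_mul_div, one_le_div (hpos _)]
    exact h
  exact_mod_cast this

theorem iInf_mixedNorm_pow_four_le {χ : EuclideanSpace ℝ (Fin d) → ℝ≥0} (c : Circle) :
    (⨅ c : Circle, mixedNorm χ (fun z => H z - (c : ℂ) * F z)) ^ 4 ≤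
      ∫⁻ τ, eLpNorm (fun z => H z - (c : ℂ) * F z) 2 (volume.restrict (Metric.ball τ 1)) ^ 4 *
        χ τ := by
  calc (⨅ c : Circle, mixedNorm χ (fun z => H z - (c : ℂ) * F z)) ^ 4
      ≤ mixedNorm χ (fun z => H z - (c : ℂ) * F z) ^ 4 := by
        gcongr
        exact iInf_le _ c
    _ = _ := by
        rw [mixedNorm, ← ENNReal.rpow_natCast, ← ENNReal.rpow_mul]
        norm_num

theorem measurable_sub_phase_mul (hF : Measurable F) (hH : Measurable H) (c : Circle) :
    Measurable fun z => H z - (c : ℂ) * F z := by fun_prop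

theorem norm_sub_phase_mul_le {b b' : ℝ} (hb : ∀ x, ‖F x‖ ≤ b) (hb' : ∀ x, ‖H x‖ ≤ b') (c : Circle)
    (x : EuclideanSpace ℝ (Fin d)) : ‖H x - (c : ℂ) * F x‖ ≤ b' + b := by
  refine (norm_sub_le _ _).trans (add_le_add (hb' x) ?_)
  rw [norm_mul, Circle.norm_coe, one_mul]
  exact hb x

/-- The mollified local phase `u` is an admissible test function in the Poincaré inequality; its
gradient is controlled by the local defects, and so is its distance from the local phase. -/
theorem exists_testFunction (hγ : Continuous γ) (hpos : ∀ z, 0 < γ z)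
    (hint : ∫⁻ z, (γ z : ℝ≥0∞) < ⊤) {B : ℝ≥0} (hB : ∀ y z, dist y z ≤ 1 → γ y ≤ B * γ z) :
    ∃ C : ℝ≥0, ∀ F H : EuclideanSpace ℝ (Fin d) → ℂ, Measurable F → Measurable H →
      (∃ b : ℝ, ∀ x, ‖F x‖ ≤ b) → (∃ b : ℝ, ∀ x, ‖H x‖ ≤ b) →
      ∃ u : EuclideanSpace ℝ (Fin d) → ℂ, IsCbSmooth u ∧ ∀ z,
        ‖u z - localPhase (localMeasure γ z) F H‖ ^ 2 * sqMass (localMeasure γ z) F ^ 2 ≤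
          C * gramDefect (localMeasure γ z) F H ∧
        ‖fderiv ℝ u z‖ ^ 2 * sqMass (localMeasure γ z) F ^ 2 ≤
          C * gramDefect (localMeasure γ z) F H := by
  obtain ⟨K, hK⟩ := exists_mollification d
  refine ⟨(max 1 K * (2 * B ^ 2)) ^ 2, fun F H hF hH ⟨b, hb⟩ ⟨b', hb'⟩ => ?_⟩
  have hmF := fun z => memLp_localMeasure hint z hF hb
  have hmH := fun z => memLp_localMeasure hint z hH hb'
  obtain ⟨u, hu, hu'⟩ := hK (fun z => localPhase (localMeasure γ z) F H)
    (measurable_localPhase hγ hF hH) fun z => norm_localPhase_le_one (hmF z) (hmH z)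
  refine ⟨u, hu, fun z => ?_⟩
  have hD := gramDefect_nonneg (hmF z) (hmH z)
  have ha := sqMass_nonneg (localMeasure γ z) F
  have hb := sqMass_nonneg (localMeasure γ z) H
  rcases ha.eq_or_lt with h0 | h0
  · rw [← h0]
    simp only [ne_eq, OfNat.ofNat_ne_zero, not_false_eq_true, zero_pow, mul_zero]
    exact ⟨by positivity, by positivity⟩
  have hN : 0 < sqMass (localMeasure γ z) F + sqMass (localMeasure γ z) H := by linarith
  obtain ⟨h1, h2⟩ := hu' z (2 * B ^ 2 * √(gramDefect (localMeasure γ z) F H) /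
    (sqMass (localMeasure γ z) F + sqMass (localMeasure γ z) H)) fun t ht => by
      rw [le_div_iff₀ hN]
      exact norm_localPhase_sub_mul_le hγ hpos hint hB hF hH ‹_› hb' ht
  have hR := Real.sqrt_nonneg (gramDefect (localMeasure γ z) F H)
  have hR2 := Real.sq_sqrt hD
  set D := gramDefect (localMeasure γ z) F H
  set a := sqMass (localMeasure γ z) F
  set N := a + sqMass (localMeasure γ z) H
  have haN : a ≤ N := by linarith
  have main : ∀ {t k : ℝ}, 0 ≤ t → 0 ≤ k → k ≤ max 1 K → t ≤ k * (2 * B ^ 2 * √D / N) →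
      t ^ 2 * a ^ 2 ≤ ((max 1 K * (2 * B ^ 2)) ^ 2 : ℝ≥0) * D := by
    intro t k ht hk hk' htk
    have e : t * a ≤ max 1 K * (2 * B ^ 2) * √D := by
      calc t * a ≤ (k * (2 * B ^ 2 * √D / N)) * N := by gcongr
        _ = k * (2 * B ^ 2) * √D := by field_simp
        _ ≤ _ := by gcongr
    push_cast
    rw [← hR2, ← mul_pow, ← mul_pow]
    exact pow_le_pow_left₀ (by positivity) e 2
  exact ⟨main (norm_nonneg _) zero_le_one (le_max_left _ _) (by rwa [one_mul]),
    main (norm_nonneg _) K.2 (le_max_right _ _) h2⟩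

/-- The phase retrieval estimate under a Poincaré inequality, in terms of the local defects. -/
theorem exists_iInf_mixedNorm_pow_four_le (hγ : Continuous γ) (hpos : ∀ z, 0 < γ z)
    (hint : ∫⁻ z, (γ z : ℝ≥0∞) < ⊤) {B : ℝ≥0} (hB0 : 0 < B)
    (hB : ∀ y z, dist y z ≤ 1 → γ y ≤ B * γ z) :
    ∃ C : ℝ≥0, ∀ F H : EuclideanSpace ℝ (Fin d) → ℂ, Measurable F → Measurable H →
      (∃ b : ℝ, ∀ x, ‖F x‖ ≤ b) → (∃ b : ℝ, ∀ x, ‖H x‖ ≤ b) →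
      ∀ χ : EuclideanSpace ℝ (Fin d) → ℝ≥0, (∀ z, χ z ≤ 1) → ∀ K : ℝ≥0,
        PoincareWith (fun z => smoothedWeight F γ z * χ z) (smoothedWeight F γ) K →
        (⨅ c : Circle, mixedNorm χ (fun z => H z - (c : ℂ) * F z)) ^ 4 ≤
          C * (1 + K) * ∫⁻ z, ENNReal.ofReal (gramDefect (localMeasure γ z) F H) := by
  obtain ⟨C, hC⟩ := exists_testFunction hγ hpos hint hB
  refine ⟨(B / γ 0) ^ 2 * ((40 + 128 * C) + 128 * (d * C)), ?_⟩
  intro F H hF hH hbF hbH χ hχ K hK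
  obtain ⟨u, hu, hu'⟩ := hC F H hF hH hbF hbH
  obtain ⟨b, hb⟩ := hbF
  obtain ⟨b', hb'⟩ := hbH
  have hmF := fun z => memLp_localMeasure hint z hF hb
  have hmH := fun z => memLp_localMeasure hint z hH hb'
  have hw := smoothedWeight_eq hγ hint hF hb
  set A := ∫⁻ z, ENNReal.ofReal (gramDefect (localMeasure γ z) F H) with hA
  have hmeas := (measurable_gramDefect hγ hF hH).ennreal_ofReal
  have hgrad : gradEnergy u (smoothedWeight F γ) ≤ (d * C : ℝ≥0) * A := by
    rw [gradEnergy, hA, ← lintegral_const_mul _ hmeas]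
    refine lintegral_mono fun z => ?_
    have h1 : ∀ l : Fin d, ‖fderiv ℝ u z (EuclideanSpace.single l 1)‖ₑ ^ 2 ≤
        ENNReal.ofReal (‖fderiv ℝ u z‖ ^ 2) := by
      intro l
      rw [← ofReal_norm, ← ENNReal.ofReal_pow (norm_nonneg _)]
      refine ENNReal.ofReal_le_ofReal ?_
      gcongr
      simpa using (fderiv ℝ u z).le_opNorm (EuclideanSpace.single l 1)
    calc (∑ l : Fin d, ‖fderiv ℝ u z (EuclideanSpace.single l 1)‖ₑ ^ 2) * smoothedWeight F γ z
        ≤ (∑ l : Fin d, ENNReal.ofReal (‖fderiv ℝ u z‖ ^ 2)) * smoothedWeight F γ z := by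
          gcongr with l
          exact h1 l
      _ = d * ENNReal.ofReal (‖fderiv ℝ u z‖ ^ 2 * sqMass (localMeasure γ z) F ^ 2) := by
          rw [hw, ENNReal.ofReal_mul (by positivity), ENNReal.ofReal_pow (sqMass_nonneg _ _)]
          simp [mul_assoc]
      _ ≤ d * ENNReal.ofReal (C * gramDefect (localMeasure γ z) F H) := by
          exact mul_le_mul_right (ENNReal.ofReal_le_ofReal (hu' z).2) _
      _ = _ := by
          rw [ENNReal.ofReal_mul (NNReal.coe_nonneg C), ENNReal.ofReal_coe_nnreal, ← mul_assoc]
          push_cast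
          rfl
  have hpt : ∀ (c : ℂ) (z : EuclideanSpace ℝ (Fin d)),
      eLpNorm (fun x => H x - (phaseOf c : ℂ) * F x) 2 (volume.restrict (Metric.ball z 1)) ^ 4 *
        χ z ≤ ((B / γ 0) ^ 2 : ℝ≥0) * ((40 + 128 * C : ℝ≥0) *
          ENNReal.ofReal (gramDefect (localMeasure γ z) F H) +
          128 * (‖u z - c‖ₑ ^ 2 * (smoothedWeight F γ z * χ z))) := by
    intro c z
    have h1 := eLpNorm_ball_pow_four_le hγ hpos hint hB (measurable_sub_phase_mul hF hH (phaseOf c))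
      (norm_sub_phase_mul_le hb hb' (phaseOf c)) z
    have h2 := sqMass_sub_phaseOf_sq_le (hmF z) (hmH z) c
    have h3 := (hu' z).1
    have hD := gramDefect_nonneg (hmF z) (hmH z)
    set D := gramDefect (localMeasure γ z) F H
    set v := localPhase (localMeasure γ z) F H
    set a := sqMass (localMeasure γ z) F
    have h4 : ‖v - c‖ ^ 2 ≤ 2 * ‖u z - v‖ ^ 2 + 2 * ‖u z - c‖ ^ 2 := by
      have := norm_sub_le_norm_sub_add_norm_sub v (u z) c
      rw [norm_sub_rev v (u z)] at this
      have := pow_le_pow_left₀ (norm_nonneg _) this 2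
      nlinarith [sq_nonneg (‖u z - v‖ - ‖u z - c‖)]
    have h5 : sqMass (localMeasure γ z) (fun x => H x - phaseOf c * F x) ^ 2 ≤
        (40 + 128 * C) * D + 128 * (‖u z - c‖ ^ 2 * a ^ 2) := by
      have := mul_le_mul_of_nonneg_right h4 (sq_nonneg a)
      linarith
    have h6 : ENNReal.ofReal (sqMass (localMeasure γ z) (fun x => H x - phaseOf c * F x) ^ 2) ≤
        (40 + 128 * C : ℝ≥0) * ENNReal.ofReal D +
          128 * (‖u z - c‖ₑ ^ 2 * smoothedWeight F γ z) := by
      refine (ENNReal.ofReal_le_ofReal h5).trans ?_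
      rw [ENNReal.ofReal_add (by positivity) (by positivity), ENNReal.ofReal_mul (by positivity),
        ENNReal.ofReal_mul (by positivity), ENNReal.ofReal_mul (by positivity),
        ENNReal.ofReal_pow (norm_nonneg _), ENNReal.ofReal_pow (sqMass_nonneg _ _), ofReal_norm,
        hw, ← ENNReal.ofReal_coe_nnreal]
      push_cast
      norm_num
    have hχ' : (χ z : ℝ≥0∞) ≤ 1 := by exact_mod_cast hχ z
    refine (mul_le_mul_left (h1.trans (mul_le_mul_right h6 _)) _).trans ?_
    rw [mul_assoc]
    gcongr
    rw [add_mul]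
    refine add_le_add (mul_le_of_le_one_right' hχ') (le_of_eq (by ring))
  have hint_c : ∀ c : ℂ, (⨅ c : Circle, mixedNorm χ (fun z => H z - (c : ℂ) * F z)) ^ 4 ≤
      ((B / γ 0) ^ 2 : ℝ≥0) * ((40 + 128 * C : ℝ≥0) * A +
        128 * ∫⁻ z, ‖u z - c‖ₑ ^ 2 * (smoothedWeight F γ z * χ z)) := by
    intro c
    refine (iInf_mixedNorm_pow_four_le (phaseOf c)).trans ?_
    refine (lintegral_mono (hpt c)).trans ?_
    rw [lintegral_const_mul' _ _ ENNReal.coe_ne_top, lintegral_add_left (hmeas.const_mul _),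
      lintegral_const_mul _ hmeas, lintegral_const_mul' _ _ (by norm_num)]
  have hinf := le_iInf hint_c
  have hne : (((B / γ 0) ^ 2 : ℝ≥0) : ℝ≥0∞) ≠ 0 := by
    exact_mod_cast (pow_pos (div_pos hB0 (hpos 0)) 2).ne'
  rw [← ENNReal.mul_iInf_of_ne hne ENNReal.coe_ne_top, ← ENNReal.add_iInf,
    ← ENNReal.mul_iInf_of_ne (by norm_num) (by norm_num)] at hinf
  refine hinf.trans ?_
  have hP := (hK u hu).trans (mul_le_mul_right hgrad (K : ℝ≥0∞))
  calc _ ≤ ((B / γ 0) ^ 2 : ℝ≥0) * ((40 + 128 * C : ℝ≥0) * A +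
        128 * (K * ((d * C : ℝ≥0) * A))) := by gcongr
    _ ≤ ((B / γ 0) ^ 2 : ℝ≥0) * (((40 + 128 * C : ℝ≥0) * (1 + K)) * A +
        (128 * (d * C : ℝ≥0) * (1 + K)) * A) := by
        refine mul_le_mul_right (add_le_add (mul_le_mul_left (le_mul_of_one_le_right'
          le_self_add) _) ?_) _
        calc (128 : ℝ≥0∞) * (K * ((d * C : ℝ≥0) * A)) = 128 * (d * C : ℝ≥0) * K * A := by ring
          _ ≤ _ := mul_le_mul_left (mul_le_mul_right le_add_self _) _
    _ = _ := by push_cast; ring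

/-- If all local defects vanish, then `F` and `H` agree up to a phase factor. -/
theorem iInf_mixedNorm_eq_zero (hγ : Continuous γ) (hpos : ∀ z, 0 < γ z)
    (hint : ∫⁻ z, (γ z : ℝ≥0∞) < ⊤) (hF : Measurable F) (hH : Measurable H)
    {b b' : ℝ} (hb : ∀ x, ‖F x‖ ≤ b) (hb' : ∀ x, ‖H x‖ ≤ b')
    (h0 : ∫⁻ z, ENNReal.ofReal (gramDefect (localMeasure γ z) F H) = 0)
    (χ : EuclideanSpace ℝ (Fin d) → ℝ≥0) :
    (⨅ c : Circle, mixedNorm χ (fun z => H z - (c : ℂ) * F z)) = 0 := by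
  have hmF := fun z => memLp_localMeasure hint z hF hb
  have hmH := fun z => memLp_localMeasure hint z hH hb'
  have hγm := hγ.measurable
  rw [lintegral_eq_zero_iff (measurable_gramDefect hγ hF hH).ennreal_ofReal] at h0
  obtain ⟨z, hz⟩ := h0.exists
  have hz : gramDefect (localMeasure γ z) F H ≤ 0 := ENNReal.ofReal_eq_zero.1 hz
  have h1 := sqMass_sub_phaseOf_sq_le (hmF z) (hmH z) (localPhase (localMeasure γ z) F H)
  rw [sub_self, norm_zero] at h1
  set c := phaseOf (localPhase (localMeasure γ z) F H)
  have h2 : sqMass (localMeasure γ z) (fun x => H x - c * F x) = 0 := by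
    refine pow_eq_zero_iff (n := 2) (by norm_num) |>.1 (le_antisymm ?_ (sq_nonneg _))
    linarith
  have hm := memLp_localMeasure hint z (measurable_sub_phase_mul hF hH c)
    (norm_sub_phase_mul_le hb hb' c)
  have h3 := ofReal_sqMass hm
  have hmeas : Measurable fun x => ‖H x - (c : ℂ) * F x‖ₑ ^ 2 :=
    (measurable_sub_phase_mul hF hH c).enorm.pow_const 2
  rw [h2, ENNReal.ofReal_zero, eq_comm, lintegral_eq_zero_iff hmeas] at h3
  have hac : volume ≪ localMeasure γ z := withDensity_absolutelyContinuous' (by fun_prop)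
    (.of_forall fun x => by exact_mod_cast (hpos _).ne')
  have h4 : (fun x => H x - (c : ℂ) * F x) =ᵐ[volume] 0 := by
    filter_upwards [hac.ae_le h3] with x hx
    simpa using hx
  have h5 := iInf_mixedNorm_pow_four_le (F := F) (H := H) (χ := χ) c
  have h6 : ∀ τ, eLpNorm (fun z => H z - (c : ℂ) * F z) 2
      (volume.restrict (Metric.ball τ 1)) = 0 := fun τ => by
    rw [eLpNorm_congr_ae (ae_restrict_of_ae h4)]; simp
  simp only [h6] at h5
  simpa using h5

end LocalEstimates

/-! ### The estimate for admissible pairs -/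

section PhaseRetrieval

theorem exists_measurable_of_mem_stftRange {g g' : ℝ → ℂ} (hg : g =ᵐ[volume] g')
    {F : EuclideanSpace ℝ (Fin 2) → ℂ} (hF : F ∈ stftRange g) :
    ∃ f, Measurable f ∧ MemLp f 2 ∧ F = stft g' f := by
  obtain ⟨f, hf, rfl⟩ := hF
  exact ⟨hf.1.mk f, hf.1.stronglyMeasurable_mk.measurable, hf.ae_eq hf.1.ae_eq_mk,
    stft_congr hf.1.ae_eq_mk hg⟩

theorem exists_norm_stft_le {f g : ℝ → ℂ} (hf : MemLp f 2) (hg : MemLp g 2) :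
    ∃ b : ℝ, ∀ z, ‖stft g f z‖ ≤ b := by
  refine ⟨(eLpNorm f 2 volume * eLpNorm g 2 volume).toReal, fun z => ?_⟩
  rw [← toReal_enorm]
  exact ENNReal.toReal_mono (ENNReal.mul_lt_top hf.2 hg.2).ne (enorm_stft_le hf hg z)

theorem ae_eq_zero_of_stft_self_zero {g : ℝ → ℂ} (hg : MemLp g 2) (h : stft g g 0 = 0) :
    g =ᵐ[volume] 0 := by
  have h1 : ∫ t, ‖g t‖ ^ 2 = 0 := by
    apply Complex.ofReal_injective
    rw [← integral_complex_ofReal, Complex.ofReal_zero, ← h, stft]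
    refine integral_congr_ae (.of_forall fun t => ?_)
    simp [Complex.mul_conj, Complex.normSq_eq_norm_sq]
  rw [integral_eq_zero_iff_of_nonneg (fun t => by positivity)
    (hg.integrable_norm_pow (by norm_num))] at h1
  filter_upwards [h1] with t ht
  simpa using ht

theorem phaselessDist_pow_four {d : ℕ} (F H : EuclideanSpace ℝ (Fin d) → ℂ) :
    phaselessDist (fun z => ‖F z‖) (fun z => ‖H z‖) ^ 4 =
      ∫⁻ z, ‖F z * conj (F z) - H z * conj (H z)‖ₑ ^ 2 := by
  have e : phaselessDist (fun z => ‖F z‖) (fun z => ‖H z‖) ^ 4 =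
      eLpNorm (fun z => F z * conj (F z) - H z * conj (H z)) 2 volume ^ 2 := by
    rw [phaselessDist, ← ENNReal.rpow_natCast, ← ENNReal.rpow_mul,
      eLpNorm_congr_norm_ae (g := fun z => F z * conj (F z) - H z * conj (H z))
        (.of_forall fun z => ?_)]
    · norm_num
    · simp only [Complex.mul_conj, Complex.normSq_eq_norm_sq]
      rw [← Complex.ofReal_sub, Complex.norm_real]
  rw [e, eLpNorm_two_sq]

/-- A bound that holds for every Poincaré constant of a pair of weights holds for the best one. -/
theorem le_mul_poincareConst {d : ℕ} {v w : EuclideanSpace ℝ (Fin d) → ℝ≥0∞} {X Y : ℝ≥0∞}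
    (h0 : Y ≠ 0) (htop : Y ≠ ⊤) (h : ∀ K : ℝ≥0, PoincareWith v w K → X ≤ (1 + K) * Y) :
    X ≤ (1 + poincareConst v w) * Y := by
  rw [← ENNReal.div_le_iff h0 htop, ← tsub_le_iff_left, poincareConst]
  refine le_iInf₂ fun K hK => ?_
  rw [tsub_le_iff_left, ENNReal.div_le_iff h0 htop]
  exact h K hK

end PhaseRetrieval

theorem theorem1p10 (g : ℝ → ℂ) (γ : EuclideanSpace ℝ (Fin 2) → ℝ≥0)
    (hadm : IsAdmissiblePair g γ) (hγ : γ ≠ 0) :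
    ∃ C : ℝ≥0, 0 < C ∧
      ∀ χ : EuclideanSpace ℝ (Fin 2) → ℝ≥0, Measurable χ → (∀ z, χ z ≤ 1) →
        ∀ F ∈ stftRange g, ∀ H ∈ stftRange g,
          (⨅ c : Circle, mixedNorm χ (fun z => H z - (c : ℂ) * F z)) ≤
            C * (1 + poincareConst (fun z => smoothedWeight F γ z * χ z) (smoothedWeight F γ))
                ^ (1 / 4 : ℝ)
              * phaselessDist (fun z => ‖F z‖) (fun z => ‖H z‖) := by
  obtain ⟨hg, hT, μ, hμ, hμL⟩ := hadm
  by_cases hg0 : stft g g 0 = 0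
  · -- The window vanishes, and with it all short-time Fourier transforms.
    have hgz := ae_eq_zero_of_stft_self_zero hg hg0
    refine ⟨1, one_pos, fun χ _ _ F hF H hH => ?_⟩
    have hz : ∀ G ∈ stftRange g, G = fun _ => 0 := by
      rintro G ⟨f, _, rfl⟩
      rw [stft_congr (ae_eq_refl f) hgz]
      funext z
      simp [stft]
    refine (iInf_le _ 1).trans ?_
    rw [hz F hF, hz H hH]
    simp [mixedNorm]
  have hγc : Continuous γ := by
    obtain ⟨_, h⟩ := hT
    exact h.continuous
  have hpos := hT.pos hγ
  obtain ⟨B, hB0, hB⟩ := hT.exists_le_mul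
  have h1 : ∀ z, 1 ≤ μ z * μ (-z) := by
    intro z
    have a := hμ.le_mul 0 z
    have b := hμ.le_mul z (-z)
    rw [zero_add] at a
    rw [add_neg_cancel] at b
    have h0 : 0 < ‖stft g g 0‖₊ := nnnorm_pos.2 hg0
    refine le_of_mul_le_mul_right (a := ‖stft g g 0‖₊) ?_ h0
    calc 1 * ‖stft g g 0‖₊ ≤ μ (-z) * ‖stft g g z‖₊ := by rw [one_mul]; exact b
      _ ≤ μ (-z) * (μ z * ‖stft g g 0‖₊) := by gcongr
      _ = μ z * μ (-z) * ‖stft g g 0‖₊ := by ring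
  have hint := lintegral_weight_lt_top hγc hpos hμL h1
  have hM := lintegral_selfCorrelation_mul_sq_lt_top hγc hμL
  obtain ⟨C, hC⟩ := exists_iInf_mixedNorm_pow_four_le hγc hpos hint hB0 hB
  set M := ∫⁻ z, selfCorrelation γ z * (μ z : ℝ≥0∞) ^ 2
  set C' : ℝ≥0 := 1 + C * M.toNNReal with hC'
  have hC1 : 1 ≤ C' := le_self_add
  refine ⟨C', by positivity, fun χ _ hχ F hF H hH => ?_⟩
  obtain ⟨f, hfm, hf, hFe⟩ := exists_measurable_of_mem_stftRange hg.1.ae_eq_mk hF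
  obtain ⟨h, hhm, hh, hHe⟩ := exists_measurable_of_mem_stftRange hg.1.ae_eq_mk hH
  have hgg := stft_congr hg.1.ae_eq_mk hg.1.ae_eq_mk
  have hgm := hg.1.stronglyMeasurable_mk.measurable
  have hg' := hg.ae_eq hg.1.ae_eq_mk
  have hFm : Measurable F := hFe ▸ measurable_stft hfm hgm
  have hHm : Measurable H := hHe ▸ measurable_stft hhm hgm
  have hFb : ∃ b : ℝ, ∀ z, ‖F z‖ ≤ b := hFe ▸ exists_norm_stft_le hf hg'
  have hHb : ∃ b : ℝ, ∀ z, ‖H z‖ ≤ b := hHe ▸ exists_norm_stft_le hh hg'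
  set Q := ∫⁻ z, ‖F z * conj (F z) - H z * conj (H z)‖ₑ ^ 2 with hQ
  have hQt : Q ≠ ⊤ := by
    rw [hQ, hFe, hHe]
    exact (lintegral_enorm_sq_lt_top ((memLp_stft_mul hfm hgm hf hg' hgm hg').sub
      (memLp_stft_mul hhm hgm hh hg' hgm hg'))).ne
  have hcor : ∀ τ, ∫⁻ x, ‖F x * conj (F (x - τ)) - H x * conj (H (x - τ))‖ₑ ^ 2 ≤
      μ τ ^ 2 * Q := by
    intro τ
    rw [hQ, hFe, hHe]
    refine lintegral_correlation_sub_le hfm hgm hhm hf hg' hh (m := μ τ) fun z => ?_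
    rw [← hgg]
    have := ENNReal.coe_le_coe.2 (hμ.le_mul z τ)
    rwa [ENNReal.coe_mul] at this
  obtain ⟨b, hb⟩ := id hFb
  obtain ⟨b', hb'⟩ := id hHb
  have hA := lintegral_gramDefect_le hγc hint hFm hHm hb hb' hQt hcor
  have hdist : phaselessDist (fun z => ‖F z‖) (fun z => ‖H z‖) ^ 4 = Q :=
    phaselessDist_pow_four F H
  set I := ⨅ c : Circle, mixedNorm χ (fun z => H z - (c : ℂ) * F z)
  -- For `Q = 0` the product with an infinite Poincaré constant is zero by convention, so that this
  -- case needs an argument without a Poincaré inequality.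
  by_cases hQ0 : Q = 0
  · rw [hQ0, mul_zero] at hA
    have : I = 0 := iInf_mixedNorm_eq_zero hγc hpos hint hFm hHm hb hb'
      (le_antisymm hA zero_le) χ
    rw [this]
    exact zero_le
  have hM' : M = (M.toNNReal : ℝ≥0∞) := (ENNReal.coe_toNNReal hM.ne).symm
  have hI : I ^ 4 ≤ (1 + poincareConst (fun z => smoothedWeight F γ z * χ z)
      (smoothedWeight F γ)) * (C' * Q) := by
    refine le_mul_poincareConst (mul_ne_zero (by exact_mod_cast (by positivity)) hQ0)
      (ENNReal.mul_ne_top ENNReal.coe_ne_top hQt) fun K hK => ?_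
    calc I ^ 4 ≤ C * (1 + K) * (M * Q) :=
          (hC F H hFm hHm hFb hHb χ hχ K hK).trans (mul_le_mul_right hA _)
      _ = (1 + K) * ((C * M.toNNReal : ℝ≥0) * Q) := by
          rw [ENNReal.coe_mul, ← hM']; ring
      _ ≤ (1 + K) * (C' * Q) := by
          refine mul_le_mul_right (mul_le_mul_left ?_ _) _
          exact ENNReal.coe_le_coe.2 le_add_self
  set P := 1 + poincareConst (fun z => smoothedWeight F γ z * χ z) (smoothedWeight F γ)
  refine (ENNReal.pow_right_strictMono (n := 4) (by norm_num)).le_iff_le.1 ?_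
  rw [mul_pow, mul_pow, hdist]
  have hP : (P ^ (1 / 4 : ℝ)) ^ 4 = P := by
    rw [← ENNReal.rpow_natCast, ← ENNReal.rpow_mul]
    norm_num
  rw [hP]
  refine hI.trans ?_
  rw [← mul_assoc, mul_comm P]
  gcongr
  exact le_self_pow (by exact_mod_cast hC1) (by norm_num)
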